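/- Let $0<r<1/2$, $0<2\omega<1-2r$ and $s=\frac{r}{2-4r-2\omega}$. All limits and the relations $\asymp$, $o$ are taken as $\varepsilon\to0+$. In the Gaussian white noise model $dY_\varepsilon(t)=S(t)\,dt+\varepsilon\,dw(t)$, $t\in(0,1)$, $S\in L_2(0,1)$, let $(\phi_j)_{j\ge1}$ be an orthonormal system in $L_2(0,1)$, and observe $y_{\varepsilon j}=\theta_j+\varepsilon\xi_j$, where $\theta_j=\int_0^1S\phi_j\,dt$ and the $\xi_j$ are i.i.d. $N(0,1)$. For each $\varepsilon>0$ let $(\varkappa_{\varepsilon j}^2)_{j\ge1}$ be nonnegative weights with finite sum $\rho_\varepsilon^2=\sum_j\varkappa_{\varepsilon j}^2$, and put $A_\varepsilon=\varepsilon^{-4}\sum_j\varkappa_{\varepsilon j}^4$, $k_\varepsilon=\sup\{k:\sum_{j<k}\varkappa_{\varepsilon j}^2\le\frac12\rho_\varepsilon^2\}$, $\varkappa_\varepsilon^2=\varkappa_{\varepsilon k_\varepsilon}^2$. Let $k_\varepsilon\asymp\varepsilon^{-4+8r+4\omega}$ and assume A1. For each $\varepsilon>0$ the sequence $j\mapsto\varkappa_{\varepsilon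 j}^2$ is non-increasing. A2. There are constants $0<C_1<C_2$ with $C_1<A_\varepsilon<C_2$ for all $\varepsilon>0$. A3. There are $C_1>0$ and $\lambda>1$ such that $\varkappa^2_{\varepsilon,[(1+d)k_\varepsilon]}<C_1(1+d)^{-\lambda}\varkappa_\varepsilon^2$ for all $d>0$, $\varepsilon>0$. A4. $\varkappa_{\varepsilon1}^2\asymp\varkappa_\varepsilon^2$, and for every $c_0>1$ there is $C>0$ with $\varkappa^2_{\varepsilon,[c_0k_\varepsilon]}\ge C\varkappa_\varepsilon^2$ for all $\varepsilon>0$. Let $T_\varepsilon=\varepsilon^{-2}\sum_j\varkappa_{\varepsilon j}^2y_{\varepsilon j}^2-\rho_\varepsilon^2$. For a family of thresholds $x_\varepsilon\in\mathbb R$ let $L_\varepsilon=\mathbf 1\{\varepsilon^{-2}(2A_\varepsilon)^{-1/2}T_\varepsilon>x_\varepsilon\}$, with type I error $\alpha(L_\varepsilon)=\mathbf E_0L_\varepsilon$ and type II error $\beta(L_\varepsilon,S)=\mathbf E_S(1-L_\varepsilon)$. Put $D_\varepsilon(S)=\varepsilon^{-4}\sum_j\varkappa_{\varepsilon j}^2\theta_j^2$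 and $B_\varepsilon(S)=D_\varepsilon(S)/(2A_\varepsilon)^{1/2}$. A family $S_\varepsilon$ is called $\varepsilon^{-2\omega}$-LD consistent if, for every family of such tests with $\varepsilon^{4\omega}\log\alpha(L_\varepsilon)\to0$, there is $C>0$ with $|\log\beta(L_\varepsilon,S_\varepsilon)|\ge C\varepsilon^{-4\omega}$ for all sufficiently small $\varepsilon$ (where $|\log0|=\infty$). For $P_0>0$ put $$\bar{\mathbb B}^s_{2\infty}(P_0)=\Bigl\{S=\sum_j\theta_j\phi_j:\ \sup_{t>0}t^{2s}\sum_{j>t}\theta_j^2\le P_0\Bigr\}.$$ **Theorem.** Let $\delta>0$, $c>0$, and let $S_\varepsilon\in L_2(0,1)$ be an $\varepsilon^{-2\omega}$-LD consistent family with $\|S_\varepsilon\|\asymp\varepsilon^{2r}$. Then there are $P_0>0$ and functions $S_{1\varepsilon}\in\bar{\mathbb B}^s_{2\infty}(P_0)$, $\varepsilon>0$, with $\|S_{1\varepsilon}\|\asymp\varepsilon^{2r}$ and with $S_{1\varepsilon}$ orthogonal to $S_\varepsilon-S_{1\varepsilon}$ for all $\varepsilon>0$, such that the following holds. For every family of tests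 $L_\varepsilon$ of the above form with $\alpha(L_\varepsilon)\to0$ and $$D_\varepsilon(S_\varepsilon)\to\infty,\qquad D_\varepsilon(S_\varepsilon)=o(k_\varepsilon^{1/2}),\qquad B_\varepsilon(S_\varepsilon)-x_\varepsilon\ge c\,B_\varepsilon(S_\varepsilon)\ \text{ for all sufficiently small }\varepsilon,$$ there is $\varepsilon_0>0$ such that for all $0<\varepsilon<\varepsilon_0$ $$|\log\beta(L_\varepsilon,S_\varepsilon)-\log\beta(L_\varepsilon,S_{1\varepsilon})|\le\delta\,|\log\beta(L_\varepsilon,S_\varepsilon)|,$$ $$|\log\beta(L_\varepsilon,S_\varepsilon-S_{1\varepsilon})|\le\delta\,|\log\beta(L_\varepsilon,S_\varepsilon)|.$$ -/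

import Mathlib

open MeasureTheory ProbabilityTheory Filter Topology Asymptotics
open scoped ENNReal NNReal

noncomputable section

namespace QuadTest

/-- The real Hilbert space `L₂(0,1)`. -/
abbrev L2 : Type := Lp ℝ 2 (volume.restrict (Set.Ioo (0 : ℝ) 1))

/-- The `j`-th Fourier coefficient `θ_j = ∫₀¹ S φ_j dt`. -/
def coeff (φ : ℕ+ → L2) (S : L2) (j : ℕ+) : ℝ := inner ℝ (φ j) S

/-- The set of all `S = ∑ θ_j φ_j` with `sup_{t > 0} t^{2s} ∑_{j > t} θ_j² ≤ P₀`. -/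
def besovBall (φ : ℕ+ → L2) (s P₀ : ℝ) : Set L2 :=
  {S | ∃ θ : ℕ+ → ℝ, HasSum (fun j => θ j • φ j) S ∧
    ∀ t : ℝ, 0 < t → t ^ (2 * s) * (∑' j : ℕ+, if t < (j : ℝ) then θ j ^ 2 else 0) ≤ P₀}

/-! Weights: `κ ε j`, `j ≥ 1`, is the `j`-th coefficient at noise level `ε`; it enters only
through its square, and the value at `j = 0` is never used. -/

/-- `ρ_ε² = ∑_{j ≥ 1} κ_{εj}²`. -/
def rhoSq (κ : ℝ → ℕ → ℝ) (ε : ℝ) : ℝ := ∑' j : ℕ+, κ ε j ^ 2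

/-- `A_ε = ε⁻⁴ ∑_{j ≥ 1} κ_{εj}⁴`. -/
def A (κ : ℝ → ℕ → ℝ) (ε : ℝ) : ℝ := (ε ^ 4)⁻¹ * ∑' j : ℕ+, κ ε j ^ 4

/-- `k_ε = sup {k : ∑_{1 ≤ j < k} κ_{εj}² ≤ ρ_ε² / 2}`. -/
def kEff (κ : ℝ → ℕ → ℝ) (ε : ℝ) : ℕ :=
  sSup {k : ℕ | ∑ j ∈ Finset.Ico 1 k, κ ε j ^ 2 ≤ rhoSq κ ε / 2}

/-- `κ_ε² = κ_{ε k_ε}²`. -/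
def kappaSq (κ : ℝ → ℕ → ℝ) (ε : ℝ) : ℝ := κ ε (kEff κ ε) ^ 2

/-- The weights `κ_{εj}²` have a finite sum, so that the test statistic makes sense. -/
def WeightsSummable (κ : ℝ → ℕ → ℝ) : Prop :=
  ∀ ε : ℝ, 0 < ε → Summable (fun j : ℕ+ => κ ε j ^ 2)

def CondA1 (κ : ℝ → ℕ → ℝ) : Prop :=
  ∀ ε : ℝ, 0 < ε → AntitoneOn (fun j : ℕ => κ ε j ^ 2) (Set.Ici 1)

def CondA2 (κ : ℝ → ℕ → ℝ) : Prop :=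
  ∃ C₁ C₂ : ℝ, 0 < C₁ ∧ ∀ ε : ℝ, 0 < ε → C₁ < A κ ε ∧ A κ ε < C₂

def CondA3 (κ : ℝ → ℕ → ℝ) : Prop :=
  ∃ C₁ l : ℝ, 0 < C₁ ∧ 1 < l ∧ ∀ d : ℝ, 0 < d → ∀ ε : ℝ, 0 < ε →
    κ ε ⌊(1 + d) * (kEff κ ε : ℝ)⌋₊ ^ 2 < C₁ * (1 + d) ^ (-l) * kappaSq κ ε

def CondA4 (κ : ℝ → ℕ → ℝ) : Prop :=
  ((fun ε => κ ε 1 ^ 2) =Θ[𝓝[>] (0 : ℝ)] fun ε => kappaSq κ ε) ∧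
  ∀ c : ℝ, 1 < c → ∃ C : ℝ, 0 < C ∧ ∀ ε : ℝ, 0 < ε →
    C * kappaSq κ ε ≤ κ ε ⌊c * (kEff κ ε : ℝ)⌋₊ ^ 2

/-- `D_ε(S) = ε⁻⁴ ∑ κ_{εj}² θ_j²`. -/
def D (φ : ℕ+ → L2) (κ : ℝ → ℕ → ℝ) (ε : ℝ) (S : L2) : ℝ :=
  (ε ^ 4)⁻¹ * ∑' j : ℕ+, κ ε j ^ 2 * coeff φ S j ^ 2

/-- `B_ε(S) = D_ε(S) / (2 A_ε)^{1/2}`. -/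
def B (φ : ℕ+ → L2) (κ : ℝ → ℕ → ℝ) (ε : ℝ) (S : L2) : ℝ :=
  D φ κ ε S / √(2 * A κ ε)

/-- The law of the noise `(ξ_j)`: independent standard normal coordinates. -/
def noise : Measure (ℕ+ → ℝ) := Measure.infinitePi fun _ => gaussianReal 0 1

/-- The observation `y_{εj} = θ_j + ε ξ_j` of the signal `S`. -/
def obs (φ : ℕ+ → L2) (ε : ℝ) (S : L2) (ξ : ℕ+ → ℝ) (j : ℕ+) : ℝ := coeff φ S j + ε * ξ j

/-- The test statistic `T_ε = ε⁻² ∑ κ_{εj}² y_j² - ρ_ε²`. -/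
def T (κ : ℝ → ℕ → ℝ) (ε : ℝ) (y : ℕ+ → ℝ) : ℝ :=
  (ε ^ 2)⁻¹ * (∑' j : ℕ+, κ ε j ^ 2 * y j ^ 2) - rhoSq κ ε

/-- The rejection region of the test `L_ε = 1{ε⁻² (2 A_ε)^{-1/2} T_ε > x}`
(under the hypothesis `ε⁻² (2 A_ε)^{-1/2} T_ε` has mean `0` and variance `1`). -/
def rejectRegion (κ : ℝ → ℕ → ℝ) (ε x : ℝ) : Set (ℕ+ → ℝ) :=
  {y | x < (ε ^ 2)⁻¹ * T κ ε y / √(2 * A κ ε)}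

/-- Type I error probability `α(L_ε)` of the test with threshold `x`. -/
def typeI (φ : ℕ+ → L2) (κ : ℝ → ℕ → ℝ) (ε x : ℝ) : ℝ≥0∞ :=
  noise {ξ | obs φ ε 0 ξ ∈ rejectRegion κ ε x}

/-- Type II error probability `β(L_ε, S)` of the test with threshold `x`. -/
def typeII (φ : ℕ+ → L2) (κ : ℝ → ℕ → ℝ) (ε x : ℝ) (S : L2) : ℝ≥0∞ :=
  noise {ξ | obs φ ε S ξ ∉ rejectRegion κ ε x}

/-- `|log p|`, with the value `∞` at `p = 0`. -/
def absLog (p : ℝ≥0∞) : ℝ≥0∞ := (ENNReal.log p).abs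

/-- `R_ε`-LD consistency of the family `S_ε`: for every choice of thresholds `x_ε` with
`R_ε⁻² log α(L_ε) → 0` one has `|log β(L_ε, S_ε)| = Ω(R_ε²)` as `ε → 0`. -/
def IsLDConsistent (φ : ℕ+ → L2) (κ : ℝ → ℕ → ℝ) (R : ℝ → ℝ) (S : ℝ → L2) : Prop :=
  ∀ x : ℝ → ℝ,
    Tendsto (fun ε => absLog (typeI φ κ ε (x ε)) / ENNReal.ofReal (R ε ^ 2)) (𝓝[>] 0) (𝓝 0) →
    ∃ c : ℝ, 0 < c ∧ ∀ᶠ ε in 𝓝[>] (0 : ℝ),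
      ENNReal.ofReal (c * R ε ^ 2) ≤ absLog (typeII φ κ ε (x ε) (S ε))

/-- Admissible thresholds `x_ε` for the family `S_ε`: the type I error tends to zero,
`D_ε(S_ε) → ∞`, `D_ε(S_ε) = o(k_ε^{1/2})` and `B_ε(S_ε) - x_ε = Ω(B_ε(S_ε))` with the
constant `c` in the last relation. -/
def AdmissibleTests (φ : ℕ+ → L2) (κ : ℝ → ℕ → ℝ) (c : ℝ) (S : ℝ → L2) (x : ℝ → ℝ) : Prop :=
  Tendsto (fun ε => typeI φ κ ε (x ε)) (𝓝[>] 0) (𝓝 0) ∧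
  Tendsto (fun ε => D φ κ ε (S ε)) (𝓝[>] 0) atTop ∧
  ((fun ε => D φ κ ε (S ε)) =o[𝓝[>] (0 : ℝ)] fun ε => √(kEff κ ε : ℝ)) ∧
  ∀ᶠ ε in 𝓝[>] (0 : ℝ), c * B φ κ ε (S ε) ≤ B φ κ ε (S ε) - x ε

end QuadTest

end

/-!
Write `w_j` for the weights normalised by `∑ w_j² = 1 / 2`. For the signal `S` and the threshold `x`
a type II error is the event that `∑ w_j (a_j + ξ_j)²`, where `a_j = θ_j / ε`, falls below its mean
by at least `y = B_ε(S) - x`. The cumulant generating function of this deficit is explicit and, as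
long as `w_1 t` and `w_1 B_ε(S)` are small, equals `t² / 2` up to a small relative error; Chernoff's
bound and exponential tilting turn this into `|log β| ≈ y² / 2`, so `β` depends on `S` only through
`B_ε(S)`.

Let `e = 2 - 4r - 2ω`, so that `k_ε ≍ ε^{-2e}` and `w_1 = O(ε^e)`. Comparison with a constant
threshold of non-vanishing level shows that LD consistency forces `B_ε(S) ≳ ε^{-2ω}`. Monotone
weights satisfy `w_j² ≤ 1 / (2 j)`, hence the Fourier coefficients of index above `n = K ε^{-2e}`
contribute at most `(2 K)^{-1/2} ε^e ‖S‖² / ε²`, which is of order `K^{-1/2} ε^{-2ω}` and for large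
`K` only a small fraction of `B_ε(S)`. The partial Fourier sum `S₁` of length `n` therefore has
almost the same exponent as `S`, while the exponent of `S - S₁` is negligible or absent. Finally
`n^{2s} ‖S₁‖² = O(1)` because `s = r / e`, so `S₁` stays in a fixed Besov ball.
-/

noncomputable section

namespace QuadTest

theorem exp_neg_two_le : Real.exp (-2) ≤ 1 / 4 := by
  have hneg : Real.exp (-1) ≤ 1 / 2 := by linarith [Real.exp_neg_one_lt_half]
  calc Real.exp (-2) = Real.exp (-1) * Real.exp (-1) := by rw [← Real.exp_add]; norm_num
    _ ≤ 1 / 2 * (1 / 2) := by gcongr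
    _ = 1 / 4 := by norm_num

section ExponentialTilting

variable {Ω : Type*} [MeasurableSpace Ω] {μ : Measure Ω} [IsFiniteMeasure μ] {X : Ω → ℝ}

theorem mgf_le_add_add_measureReal (hX : Measurable X) {s₀ s s₁ : ℝ} (y z : ℝ) (h₀ : s₀ ≤ s)
    (h₁ : s ≤ s₁) (hs : 0 ≤ s) (hi₀ : Integrable (fun ω => Real.exp (s₀ * X ω)) μ)
    (hi₁ : Integrable (fun ω => Real.exp (s₁ * X ω)) μ) :
    mgf X μ s ≤ Real.exp ((s - s₀) * y) * mgf X μ s₀ +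
      Real.exp (-((s₁ - s) * z)) * mgf X μ s₁ + Real.exp (s * z) * μ.real {ω | y ≤ X ω} := by
  have hmeas : MeasurableSet {ω | y ≤ X ω} := measurableSet_le measurable_const hX
  have hi₂ : Integrable ({ω | y ≤ X ω}.indicator fun _ => Real.exp (s * z)) μ :=
    (integrable_const _).indicator hmeas
  have hpt : ∀ ω, Real.exp (s * X ω) ≤ Real.exp ((s - s₀) * y) * Real.exp (s₀ * X ω) +
      Real.exp (-((s₁ - s) * z)) * Real.exp (s₁ * X ω) +
      {ω | y ≤ X ω}.indicator (fun _ => Real.exp (s * z)) ω := by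
    intro ω
    have hind : 0 ≤ {ω | y ≤ X ω}.indicator (fun _ => Real.exp (s * z)) ω :=
      Set.indicator_nonneg (fun _ _ => (Real.exp_pos _).le) ω
    rw [← Real.exp_add, ← Real.exp_add]
    rcases lt_or_ge (X ω) y with hy | hy
    · have : s * X ω ≤ (s - s₀) * y + s₀ * X ω := by nlinarith
      linarith [Real.exp_le_exp.2 this, Real.exp_pos (-((s₁ - s) * z) + s₁ * X ω)]
    rcases le_or_gt (X ω) z with hz | hz
    · rw [Set.indicator_of_mem (by exact hy)]
      linarith [Real.exp_le_exp.2 (mul_le_mul_of_nonneg_left hz hs),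
        Real.exp_pos ((s - s₀) * y + s₀ * X ω), Real.exp_pos (-((s₁ - s) * z) + s₁ * X ω)]
    · have : s * X ω ≤ -((s₁ - s) * z) + s₁ * X ω := by nlinarith
      linarith [Real.exp_le_exp.2 this, Real.exp_pos ((s - s₀) * y + s₀ * X ω)]
  have hint : mgf X μ s ≤ ∫ ω, (Real.exp ((s - s₀) * y) * Real.exp (s₀ * X ω) +
      Real.exp (-((s₁ - s) * z)) * Real.exp (s₁ * X ω) +
      {ω | y ≤ X ω}.indicator (fun _ => Real.exp (s * z)) ω) ∂μ :=
    integral_mono_of_nonneg (ae_of_all _ fun ω => (Real.exp_pos _).le)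
      (((hi₀.const_mul _).add (hi₁.const_mul _)).add hi₂) (ae_of_all _ hpt)
  rwa [integral_add (by exact (hi₀.const_mul _).add (hi₁.const_mul _)) hi₂,
    integral_add (hi₀.const_mul _) (hi₁.const_mul _), integral_const_mul, integral_const_mul,
    integral_indicator_const _ hmeas, smul_eq_mul, mul_comm (μ.real _)] at hint

theorem exp_neg_le_measureReal_of_mgf_bounds (hX : Measurable X) {κ τ y : ℝ} (hτ : 0 < τ)
    (hτ₁ : τ ≤ 1) (hκ : 0 ≤ κ) (hκτ : 26 * κ ≤ τ ^ 2) (hy : 0 ≤ y) (hyτ : 8 ≤ (τ * y) ^ 2)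
    (hint : ∀ t, 0 ≤ t → Integrable (fun ω => Real.exp (t * X ω)) μ)
    (hub : ∀ t, 0 ≤ t → mgf X μ t ≤ Real.exp ((1 + κ) * (t ^ 2 / 2)))
    (hlb : Real.exp ((1 - κ) * (((1 + τ) * y) ^ 2 / 2)) ≤ mgf X μ ((1 + τ) * y)) :
    Real.exp (-((1 + 10 * τ) * (y ^ 2 / 2))) ≤ μ.real {ω | y ≤ X ω} := by
  -- Tilting by `(1 + τ) y` moves the mass of `X` to the vicinity of `(1 + τ) y`; the window
  -- `[y, (1 + 2τ) y]` therefore carries at least half of the tilted mass.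
  set q := y ^ 2 / 2 with hq
  set E := Real.exp ((1 - κ) * (((1 + τ) * y) ^ 2 / 2)) with hE
  have hE₀ : 0 < E := Real.exp_pos _
  have hτκ : 26 * (κ * q) ≤ τ ^ 2 * q := by nlinarith [sq_nonneg y]
  have hτq : 4 ≤ τ ^ 2 * q := by nlinarith
  have hτ₂ : τ ^ 2 * q ≤ τ * q := by nlinarith [sq_nonneg y]
  have hκq : 0 ≤ κ * q := by positivity
  have hκτq : κ * q * τ ≤ κ * q := by nlinarith
  have hκτq' : κ * q * τ * τ ≤ κ * q := by nlinarith [mul_nonneg hκq hτ.le]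
  have quarter : ∀ a, a + 2 ≤ (1 - κ) * (((1 + τ) * y) ^ 2 / 2) → Real.exp a ≤ E / 4 := by
    intro a ha
    calc Real.exp a ≤ E * Real.exp (-2) := by
          rw [hE, ← Real.exp_add]; exact Real.exp_le_exp.2 (by linarith)
      _ ≤ E * (1 / 4) := by gcongr; exact exp_neg_two_le
      _ = E / 4 := by ring
  have hlow : Real.exp (((1 + τ) * y - y) * y) * mgf X μ y ≤ E / 4 := by
    refine (mul_le_mul_of_nonneg_left (hub y hy) (Real.exp_pos _).le).trans ?_
    rw [← Real.exp_add]
    exact quarter _ (by nlinarith)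
  have hhigh : Real.exp (-(((1 + 2 * τ) * y - (1 + τ) * y) * ((1 + 2 * τ) * y))) *
      mgf X μ ((1 + 2 * τ) * y) ≤ E / 4 := by
    refine (mul_le_mul_of_nonneg_left (hub _ (by positivity)) (Real.exp_pos _).le).trans ?_
    rw [← Real.exp_add]
    exact quarter _ (by nlinarith)
  have hmid : Real.exp (-((1 + 10 * τ) * q)) * Real.exp ((1 + τ) * y * ((1 + 2 * τ) * y)) ≤
      E / 4 := by
    rw [← Real.exp_add]
    exact quarter _ (by nlinarith)
  have hsplit := mgf_le_add_add_measureReal hX (μ := μ) (s := (1 + τ) * y) y ((1 + 2 * τ) * y)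
    (by nlinarith) (by nlinarith) (by positivity) (hint y hy)
    (hint ((1 + 2 * τ) * y) (by positivity))
  refine le_of_mul_le_mul_right ?_ (Real.exp_pos ((1 + τ) * y * ((1 + 2 * τ) * y)))
  linarith

end ExponentialTilting

section ScalarCgf

/-- The cumulant generating function, at `u ≥ 0`, of `E (a + ξ)² - (a + ξ)²` for a standard normal
`ξ`. -/
def quadCgf (u a : ℝ) : ℝ := u - Real.log (1 + 2 * u) / 2 + 2 * u ^ 2 * a ^ 2 / (1 + 2 * u)

variable {u : ℝ} (a : ℝ)

theorem quadCgf_nonneg (hu : 0 ≤ u) : 0 ≤ quadCgf u a := by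
  have hlog := Real.log_le_sub_one_of_pos (show 0 < 1 + 2 * u by linarith)
  have hshift : 0 ≤ 2 * u ^ 2 * a ^ 2 / (1 + 2 * u) := by positivity
  rw [quadCgf]
  linarith

theorem quadCgf_le_mul (hu : 0 ≤ u) : quadCgf u a ≤ u * (1 + a ^ 2) := by
  have hlog : 0 ≤ Real.log (1 + 2 * u) := Real.log_nonneg (by linarith)
  have hshift : 2 * u ^ 2 * a ^ 2 / (1 + 2 * u) ≤ u * a ^ 2 := by
    rw [div_le_iff₀ (by linarith)]
    nlinarith [mul_nonneg hu (sq_nonneg a)]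
  rw [quadCgf]
  linarith

theorem quadCgf_le (hu : 0 ≤ u) : quadCgf u a ≤ u ^ 2 + 2 * u ^ 2 * a ^ 2 := by
  have hlog : 2 * u - 2 * u ^ 2 ≤ Real.log (1 + 2 * u) := by
    refine le_trans ?_ (Real.le_log_one_add_of_nonneg (by linarith))
    rw [le_div_iff₀ (by linarith)]
    nlinarith [pow_nonneg hu 3]
  have hshift : 2 * u ^ 2 * a ^ 2 / (1 + 2 * u) ≤ 2 * u ^ 2 * a ^ 2 :=
    div_le_self (by positivity) (by linarith)
  rw [quadCgf]
  linarith

theorem le_quadCgf (hu : 0 ≤ u) : (1 - 8 * u) * u ^ 2 ≤ quadCgf u a := by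
  rcases le_or_gt (1 / 8) u with h | h
  · exact (mul_nonpos_of_nonpos_of_nonneg (by linarith) (sq_nonneg u)).trans (quadCgf_nonneg a hu)
  have habs : |-(2 * u)| = 2 * u := by rw [abs_neg, abs_of_nonneg (by linarith)]
  have htaylor := Real.abs_log_sub_add_sum_range_le (x := -(2 * u)) (by rw [habs]; linarith) 2
  rw [habs] at htaylor
  have hrem : (2 * u) ^ 3 / (1 - 2 * u) ≤ 16 * u ^ 3 := by
    rw [div_le_iff₀ (by linarith)]
    nlinarith [pow_nonneg hu 3]
  have hlog : Real.log (1 + 2 * u) ≤ 2 * u - 2 * u ^ 2 + 16 * u ^ 3 := by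
    have := (abs_le.1 (htaylor.trans hrem)).2
    norm_num [Finset.sum_range_succ] at this
    linarith
  have hshift : 0 ≤ 2 * u ^ 2 * a ^ 2 / (1 + 2 * u) := by positivity
  rw [quadCgf]
  linarith

theorem mgf_shifted_sq_gaussianReal (hu : 0 ≤ u) :
    mgf (fun x => 1 + a ^ 2 - (a + x) ^ 2) (gaussianReal 0 1) u = Real.exp (quadCgf u a) := by
  have hu' : 0 < 1 + 2 * u := by linarith
  have hsquare : ∀ x : ℝ,
      gaussianPDFReal 0 1 x • Real.exp (u * (1 + a ^ 2 - (a + x) ^ 2)) =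
        (√(2 * Real.pi))⁻¹ * Real.exp (u + 2 * u ^ 2 * a ^ 2 / (1 + 2 * u)) *
          Real.exp (-(1 / 2 + u) * (x + 2 * u * a / (1 + 2 * u)) ^ 2) := by
    intro x
    rw [gaussianPDFReal, smul_eq_mul, mul_assoc _ (Real.exp _), mul_assoc _ (Real.exp _),
      ← Real.exp_add, ← Real.exp_add]
    simp only [NNReal.coe_one, mul_one, sub_zero]
    congr 2
    field_simp
    ring
  have hlog : Real.exp (-(Real.log (1 + 2 * u) / 2)) = (√(1 + 2 * u))⁻¹ := by
    rw [Real.exp_neg, ← Real.log_sqrt hu'.le, Real.exp_log (Real.sqrt_pos.2 hu')]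
  have hcgf : quadCgf u a =
      u + 2 * u ^ 2 * a ^ 2 / (1 + 2 * u) + -(Real.log (1 + 2 * u) / 2) := by
    rw [quadCgf]; ring
  rw [mgf, integral_gaussianReal_eq_integral_smul one_ne_zero]
  simp_rw [hsquare]
  rw [integral_const_mul,
    integral_add_right_eq_self (fun x : ℝ => Real.exp (-(1 / 2 + u) * x ^ 2)), integral_gaussian,
    show Real.pi / (1 / 2 + u) = 2 * Real.pi / (1 + 2 * u) by field_simp,
    Real.sqrt_div (by positivity), hcgf, Real.exp_add _ (-(_ / 2)), hlog]
  field_simp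

end ScalarCgf

section QuadraticForm

variable {ι : Type*} {w a : ι → ℝ}

/-- The law of a family of independent standard normal variables indexed by `ι`; the noise of the
model is the case `ι = ℕ+`. -/
abbrev iidGaussian (ι : Type*) : Measure (ι → ℝ) := Measure.infinitePi fun _ => gaussianReal 0 1

/-- The amount by which the quadratic form `∑ w_j (a_j + ξ_j)²` falls below its mean, for
independent standard normal `ξ_j`. -/
def deficit (w a ξ : ι → ℝ) : ℝ := ∑' j, w j * (1 + a j ^ 2) - ∑' j, w j * (a j + ξ j) ^ 2

theorem measurePreserving_eval_iidGaussian (j : ι) :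
    MeasurePreserving (fun ξ : ι → ℝ => ξ j) (iidGaussian ι) (gaussianReal 0 1) :=
  measurePreserving_eval_infinitePi (fun _ : ι => gaussianReal 0 1) j

theorem mgf_weighted_sq_iidGaussian {t : ℝ} (j : ι) (ht : 0 ≤ t * w j) :
    mgf (fun ξ => w j * (1 + a j ^ 2 - (a j + ξ j) ^ 2)) (iidGaussian ι) t =
      Real.exp (quadCgf (t * w j) (a j)) := by
  rw [mgf_const_mul, mul_comm (w j), ← mgf_shifted_sq_gaussianReal _ ht,
    ← (measurePreserving_eval_iidGaussian j).map_eq,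
    mgf_map (measurePreserving_eval_iidGaussian j).aemeasurable
      (Measurable.aestronglyMeasurable (by fun_prop))]
  rfl

theorem mgf_sum_weighted_sq_iidGaussian (hw : ∀ j, 0 ≤ w j) {t : ℝ} (ht : 0 ≤ t) (F : Finset ι) :
    mgf (fun ξ => ∑ j ∈ F, w j * (1 + a j ^ 2 - (a j + ξ j) ^ 2)) (iidGaussian ι) t =
      Real.exp (∑ j ∈ F, quadCgf (t * w j) (a j)) := by
  have hind : iIndepFun (fun j (ξ : ι → ℝ) => w j * (1 + a j ^ 2 - (a j + ξ j) ^ 2))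
      (iidGaussian ι) :=
    iIndepFun_infinitePi (X := fun j x => w j * (1 + a j ^ 2 - (a j + x) ^ 2))
      fun j => by fun_prop
  rw [← Finset.sum_fn, hind.mgf_sum (fun j => by fun_prop), Real.exp_sum]
  exact Finset.prod_congr rfl fun j _ => mgf_weighted_sq_iidGaussian j (mul_nonneg ht (hw j))

theorem integrable_sq_iidGaussian (j : ι) : Integrable (fun ξ => ξ j ^ 2) (iidGaussian ι) :=
  ((measurePreserving_eval_iidGaussian j).integrable_comp (by fun_prop)).2
    (memLp_id_gaussianReal 2).integrable_sq

theorem integral_sq_iidGaussian (j : ι) : ∫ ξ, ξ j ^ 2 ∂iidGaussian ι = 1 := by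
  have hvar := variance_of_integral_eq_zero (X := fun x : ℝ => x) (μ := gaussianReal 0 1)
    (by fun_prop) integral_id_gaussianReal
  rw [variance_fun_id_gaussianReal, ← (measurePreserving_eval_iidGaussian j).map_eq,
    integral_map (measurable_pi_apply j).aemeasurable
      (Measurable.aestronglyMeasurable (by fun_prop))] at hvar
  exact hvar.symm

theorem deficit_le (hw : ∀ j, 0 ≤ w j) (ξ : ι → ℝ) :
    deficit w a ξ ≤ ∑' j, w j * (1 + a j ^ 2) :=
  sub_le_self _ (tsum_nonneg fun j => mul_nonneg (hw j) (sq_nonneg _))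

theorem summable_quadCgf (hw : ∀ j, 0 ≤ w j) (hs : Summable w)
    (ha : Summable fun j => w j * a j ^ 2) {t : ℝ} (ht : 0 ≤ t) :
    Summable fun j => quadCgf (t * w j) (a j) := by
  refine Summable.of_nonneg_of_le (fun j => quadCgf_nonneg _ (mul_nonneg ht (hw j))) (fun j => ?_)
    ((hs.add ha).mul_left t)
  refine (quadCgf_le_mul _ (mul_nonneg ht (hw j))).trans_eq ?_
  ring

variable [Countable ι]

theorem ae_summable_mul_sq (hw : ∀ j, 0 ≤ w j) (hs : Summable w) :
    ∀ᵐ ξ ∂iidGaussian ι, Summable fun j => w j * ξ j ^ 2 := by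
  have hlint : ∀ j, ∫⁻ ξ, ENNReal.ofReal (w j * ξ j ^ 2) ∂iidGaussian ι = ENNReal.ofReal (w j) := by
    intro j
    rw [← ofReal_integral_eq_lintegral_ofReal ((integrable_sq_iidGaussian j).const_mul _)
      (ae_of_all _ fun ξ => mul_nonneg (hw j) (sq_nonneg _)), integral_const_mul,
      integral_sq_iidGaussian, mul_one]
  have hfin : ∫⁻ ξ, ∑' j, ENNReal.ofReal (w j * ξ j ^ 2) ∂iidGaussian ι ≠ ∞ := by
    rw [lintegral_tsum fun j => Measurable.aemeasurable (by fun_prop)]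
    simpa only [hlint] using hs.tsum_ofReal_ne_top
  filter_upwards [ae_lt_top (by fun_prop) hfin] with ξ hξ
  refine (ENNReal.summable_toReal hξ.ne).congr fun j => ?_
  rw [ENNReal.toReal_ofReal (mul_nonneg (hw j) (sq_nonneg _))]

theorem ae_hasSum_deficit (hw : ∀ j, 0 ≤ w j) (hs : Summable w)
    (ha : Summable fun j => w j * a j ^ 2) :
    ∀ᵐ ξ ∂iidGaussian ι,
      HasSum (fun j => w j * (1 + a j ^ 2 - (a j + ξ j) ^ 2)) (deficit w a ξ) := by
  filter_upwards [ae_summable_mul_sq hw hs] with ξ hξ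
  have hmean : Summable fun j => w j * (1 + a j ^ 2) :=
    (hs.add ha).congr fun j => by ring
  have hquad : Summable fun j => w j * (a j + ξ j) ^ 2 := by
    refine Summable.of_nonneg_of_le (fun j => mul_nonneg (hw j) (sq_nonneg _)) (fun j => ?_)
      ((ha.add hξ).mul_left 2)
    nlinarith [mul_nonneg (hw j) (sq_nonneg (a j - ξ j))]
  simpa only [deficit, mul_sub] using hmean.hasSum.sub hquad.hasSum

theorem measurable_deficit : Measurable (deficit w a) :=
  measurable_const.sub (Measurable.tsum fun _ => by fun_prop)

theorem integrable_exp_mul_deficit (hw : ∀ j, 0 ≤ w j) {t : ℝ} (ht : 0 ≤ t) :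
    Integrable (fun ξ => Real.exp (t * deficit w a ξ)) (iidGaussian ι) := by
  refine Integrable.of_bound
    (Real.measurable_exp.comp (measurable_deficit.const_mul t)).aestronglyMeasurable
    (Real.exp (t * ∑' j, w j * (1 + a j ^ 2))) (ae_of_all _ fun ξ => ?_)
  rw [Real.norm_eq_abs, Real.abs_exp]
  exact Real.exp_le_exp.2 (mul_le_mul_of_nonneg_left (deficit_le hw ξ) ht)

theorem mgf_deficit (hw : ∀ j, 0 ≤ w j) (hs : Summable w)
    (ha : Summable fun j => w j * a j ^ 2) {t : ℝ} (ht : 0 ≤ t) :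
    mgf (deficit w a) (iidGaussian ι) t = Real.exp (∑' j, quadCgf (t * w j) (a j)) := by
  have hmean : Summable fun j => w j * (1 + a j ^ 2) :=
    (hs.add ha).congr fun j => by ring
  have hlim : Tendsto (fun F : Finset ι =>
      mgf (fun ξ => ∑ j ∈ F, w j * (1 + a j ^ 2 - (a j + ξ j) ^ 2)) (iidGaussian ι) t) atTop
      (𝓝 (mgf (deficit w a) (iidGaussian ι) t)) := by
    refine tendsto_integral_filter_of_dominated_convergence
      (fun _ => Real.exp (t * ∑' j, w j * (1 + a j ^ 2)))
      (Eventually.of_forall fun F => Measurable.aestronglyMeasurable (by fun_prop))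
      (Eventually.of_forall fun F => ae_of_all _ fun ξ => ?_) (integrable_const _) ?_
    · rw [Real.norm_eq_abs, Real.abs_exp]
      refine Real.exp_le_exp.2 (mul_le_mul_of_nonneg_left ?_ ht)
      calc ∑ j ∈ F, w j * (1 + a j ^ 2 - (a j + ξ j) ^ 2)
          ≤ ∑ j ∈ F, w j * (1 + a j ^ 2) :=
            Finset.sum_le_sum fun j _ =>
              mul_le_mul_of_nonneg_left (sub_le_self _ (sq_nonneg _)) (hw j)
        _ ≤ ∑' j, w j * (1 + a j ^ 2) :=
            hmean.sum_le_tsum F fun j _ => mul_nonneg (hw j) (by positivity)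
    · filter_upwards [ae_hasSum_deficit hw hs ha] with ξ hξ
      exact (Real.continuous_exp.tendsto _).comp (hξ.const_mul t)
  simp_rw [mgf_sum_weighted_sq_iidGaussian hw ht] at hlim
  exact tendsto_nhds_unique hlim
    ((Real.continuous_exp.tendsto _).comp (summable_quadCgf hw hs ha ht).hasSum)

section Bounds

variable {m : ℝ}

theorem mgf_deficit_le (hw : ∀ j, 0 ≤ w j) (hm : ∀ j, w j ≤ m) (hs : Summable w)
    (hq : Summable fun j => w j ^ 2) (ha : Summable fun j => w j * a j ^ 2)
    {t : ℝ} (ht : 0 ≤ t) :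
    mgf (deficit w a) (iidGaussian ι) t ≤
      Real.exp (t ^ 2 * (∑' j, w j ^ 2 + 2 * (m * ∑' j, w j * a j ^ 2))) := by
  rw [mgf_deficit hw hs ha ht, Real.exp_le_exp]
  refine hasSum_le (fun j => ?_) (summable_quadCgf hw hs ha ht).hasSum
    ((hq.hasSum.add ((ha.hasSum.mul_left m).mul_left 2)).mul_left (t ^ 2))
  have hwm : w j * w j * a j ^ 2 ≤ m * w j * a j ^ 2 := by
    gcongr
    exacts [hw j, hm j]
  refine (quadCgf_le _ (mul_nonneg ht (hw j))).trans ?_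
  nlinarith [mul_le_mul_of_nonneg_left hwm (sq_nonneg t)]

theorem le_mgf_deficit (hw : ∀ j, 0 ≤ w j) (hm : ∀ j, w j ≤ m) (hs : Summable w)
    (hq : Summable fun j => w j ^ 2) (ha : Summable fun j => w j * a j ^ 2)
    {t : ℝ} (ht : 0 ≤ t) :
    Real.exp (t ^ 2 * ((1 - 8 * (t * m)) * ∑' j, w j ^ 2)) ≤
      mgf (deficit w a) (iidGaussian ι) t := by
  rw [mgf_deficit hw hs ha ht, Real.exp_le_exp]
  refine hasSum_le (fun j => ?_) ((hq.hasSum.mul_left (1 - 8 * (t * m))).mul_left (t ^ 2))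
    (summable_quadCgf hw hs ha ht).hasSum
  have htm : t * w j ≤ t * m := mul_le_mul_of_nonneg_left (hm j) ht
  calc t ^ 2 * ((1 - 8 * (t * m)) * w j ^ 2) = (1 - 8 * (t * m)) * (t * w j) ^ 2 := by ring
    _ ≤ (1 - 8 * (t * w j)) * (t * w j) ^ 2 := by gcongr
    _ ≤ quadCgf (t * w j) (a j) := le_quadCgf _ (mul_nonneg ht (hw j))

theorem measureReal_le_deficit_le (hw : ∀ j, 0 ≤ w j) (hm : ∀ j, w j ≤ m) (hs : Summable w)
    (hq : HasSum (fun j => w j ^ 2) (1 / 2)) (ha : Summable fun j => w j * a j ^ 2)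
    {y : ℝ} (hy : 0 ≤ y) :
    (iidGaussian ι).real {ξ | y ≤ deficit w a ξ} ≤
      Real.exp (-((1 - 4 * (m * ∑' j, w j * a j ^ 2)) * (y ^ 2 / 2))) := by
  calc (iidGaussian ι).real {ξ | y ≤ deficit w a ξ}
      ≤ Real.exp (-y * y) * mgf (deficit w a) (iidGaussian ι) y :=
        measure_ge_le_exp_mul_mgf y hy (integrable_exp_mul_deficit hw hy)
    _ ≤ Real.exp (-y * y) *
          Real.exp (y ^ 2 * (∑' j, w j ^ 2 + 2 * (m * ∑' j, w j * a j ^ 2))) := by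
        gcongr
        exact mgf_deficit_le hw hm hs hq.summable ha hy
    _ = Real.exp (-((1 - 4 * (m * ∑' j, w j * a j ^ 2)) * (y ^ 2 / 2))) := by
        rw [hq.tsum_eq, ← Real.exp_add]
        ring_nf

theorem exp_neg_le_measureReal_le_deficit (hw : ∀ j, 0 ≤ w j) (hm : ∀ j, w j ≤ m)
    (hs : Summable w) (hq : HasSum (fun j => w j ^ 2) (1 / 2))
    (ha : Summable fun j => w j * a j ^ 2) {τ y : ℝ} (hτ : 0 < τ) (hτ₁ : τ ≤ 1) (hy : 0 ≤ y)
    (hyτ : 8 ≤ (τ * y) ^ 2) (hmy : 416 * (m * y) ≤ τ ^ 2)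
    (hma : 104 * (m * ∑' j, w j * a j ^ 2) ≤ τ ^ 2) :
    Real.exp (-((1 + 10 * τ) * (y ^ 2 / 2))) ≤
      (iidGaussian ι).real {ξ | y ≤ deficit w a ξ} := by
  refine exp_neg_le_measureReal_of_mgf_bounds measurable_deficit hτ hτ₁ (κ := τ ^ 2 / 26)
    (by positivity) (by linarith) hy hyτ (fun t ht => integrable_exp_mul_deficit hw ht)
    (fun t ht => (mgf_deficit_le hw hm hs hq.summable ha ht).trans (Real.exp_le_exp.2 ?_))
    (le_trans (Real.exp_le_exp.2 ?_)
      (le_mgf_deficit hw hm hs hq.summable ha (t := (1 + τ) * y) (by positivity)))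
  · rw [hq.tsum_eq]
    nlinarith [sq_nonneg t]
  · rw [hq.tsum_eq]
    have hκ : 8 * ((1 + τ) * y * m) ≤ τ ^ 2 / 26 := by
      rcases le_total (m * y) 0 with h | h
      · nlinarith [mul_nonneg hτ.le (neg_nonneg.2 h)]
      · nlinarith [mul_le_mul_of_nonneg_right hτ₁ h]
    nlinarith [sq_nonneg ((1 + τ) * y)]

end Bounds

end QuadraticForm

section FourierSum

variable {𝕜 E ι : Type*} [RCLike 𝕜] [NormedAddCommGroup E] [InnerProductSpace 𝕜 E] {φ : ι → E}

variable (𝕜) in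
/-- The partial sum over `F` of the Fourier series of `x` in the system `φ`. -/
def fourierSum (φ : ι → E) (F : Finset ι) (x : E) : E := ∑ j ∈ F, inner 𝕜 (φ j) x • φ j

theorem inner_fourierSum [DecidableEq ι] (hφ : Orthonormal 𝕜 φ) (F : Finset ι) (x : E) (j : ι) :
    inner 𝕜 (φ j) (fourierSum 𝕜 φ F x) = if j ∈ F then inner 𝕜 (φ j) x else 0 := by
  simp only [fourierSum, inner_sum, inner_smul_right, orthonormal_iff_ite.1 hφ, mul_ite, mul_one,
    mul_zero, Finset.sum_ite_eq]

theorem inner_fourierSum_sub_fourierSum (hφ : Orthonormal 𝕜 φ) (F : Finset ι) (x : E) :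
    inner 𝕜 (fourierSum 𝕜 φ F x) (x - fourierSum 𝕜 φ F x) = 0 := by
  classical
  rw [fourierSum, sum_inner]
  refine Finset.sum_eq_zero fun j hj => ?_
  rw [← fourierSum, inner_smul_left, inner_sub_right, inner_fourierSum hφ, if_pos hj, sub_self,
    mul_zero]

theorem norm_fourierSum_sq_add_norm_sub_sq (hφ : Orthonormal 𝕜 φ) (F : Finset ι) (x : E) :
    ‖fourierSum 𝕜 φ F x‖ ^ 2 + ‖x - fourierSum 𝕜 φ F x‖ ^ 2 = ‖x‖ ^ 2 := by
  have hpyth := norm_add_sq (𝕜 := 𝕜) (fourierSum 𝕜 φ F x) (x - fourierSum 𝕜 φ F x)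
  rw [inner_fourierSum_sub_fourierSum hφ, map_zero, add_sub_cancel] at hpyth
  rw [hpyth, mul_zero, add_zero]

theorem norm_fourierSum_le (hφ : Orthonormal 𝕜 φ) (F : Finset ι) (x : E) :
    ‖fourierSum 𝕜 φ F x‖ ≤ ‖x‖ :=
  le_of_sq_le_sq (norm_fourierSum_sq_add_norm_sub_sq hφ F x ▸
    le_add_of_nonneg_right (sq_nonneg _)) (norm_nonneg x)

theorem norm_sub_fourierSum_le (hφ : Orthonormal 𝕜 φ) (F : Finset ι) (x : E) :
    ‖x - fourierSum 𝕜 φ F x‖ ≤ ‖x‖ :=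
  le_of_sq_le_sq (norm_fourierSum_sq_add_norm_sub_sq hφ F x ▸
    le_add_of_nonneg_left (sq_nonneg _)) (norm_nonneg x)

theorem hasSum_fourierSum (hφ : Orthonormal 𝕜 φ) (F : Finset ι) (x : E) :
    HasSum (fun j => inner 𝕜 (φ j) (fourierSum 𝕜 φ F x) • φ j) (fourierSum 𝕜 φ F x) := by
  classical
  simp only [inner_fourierSum hφ, ite_smul, zero_smul]
  have hF : fourierSum 𝕜 φ F x = ∑ j ∈ F, if j ∈ F then inner 𝕜 (φ j) x • φ j else 0 :=
    Finset.sum_congr rfl fun j hj => (if_pos hj).symm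
  exact hF ▸ hasSum_sum_of_ne_finset_zero fun j hj => if_neg hj

end FourierSum

section Truncation

variable {φ : ℕ+ → L2}

/-- The part `∑_{j ≤ n} θ_j φ_j` of the signal `S`. -/
def truncation (φ : ℕ+ → L2) (n : ℕ) (S : L2) : L2 := fourierSum ℝ φ (Finset.Iio n.succPNat) S

theorem coeff_truncation (hφ : Orthonormal ℝ φ) (n : ℕ) (S : L2) (j : ℕ+) :
    coeff φ (truncation φ n S) j = if (j : ℕ) ≤ n then coeff φ S j else 0 := by
  simp only [coeff, truncation, inner_fourierSum hφ, Finset.mem_Iio, ← PNat.coe_lt_coe,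
    Nat.succPNat_coe, Nat.lt_succ_iff]

theorem coeff_sub_truncation (hφ : Orthonormal ℝ φ) (n : ℕ) (S : L2) (j : ℕ+) :
    coeff φ (S - truncation φ n S) j = if (j : ℕ) ≤ n then 0 else coeff φ S j := by
  have hsub : coeff φ (S - truncation φ n S) j = coeff φ S j - coeff φ (truncation φ n S) j :=
    inner_sub_right _ _ _
  rw [hsub, coeff_truncation hφ]
  split_ifs <;> simp

theorem summable_coeff_sq (hφ : Orthonormal ℝ φ) (S : L2) : Summable fun j => coeff φ S j ^ 2 := by
  simpa only [coeff, Real.norm_eq_abs, sq_abs] using hφ.inner_products_summable (x := S)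

theorem tsum_coeff_sq_le (hφ : Orthonormal ℝ φ) (S : L2) : ∑' j, coeff φ S j ^ 2 ≤ ‖S‖ ^ 2 := by
  simpa only [coeff, Real.norm_eq_abs, sq_abs] using hφ.tsum_inner_products_le (x := S)

theorem truncation_mem_besovBall (hφ : Orthonormal ℝ φ) (n : ℕ) (S : L2) {s P₀ : ℝ} (hs : 0 < s)
    (hP : (n : ℝ) ^ (2 * s) * ‖S‖ ^ 2 ≤ P₀) : truncation φ n S ∈ besovBall φ s P₀ := by
  refine ⟨_, hasSum_fourierSum hφ _ S, fun t ht => le_trans ?_ hP⟩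
  change t ^ (2 * s) *
    (∑' j : ℕ+, if t < (j : ℝ) then coeff φ (truncation φ n S) j ^ 2 else 0) ≤ _
  rcases lt_or_ge t n with htn | htn
  · have hle : ∀ j : ℕ+, (if t < (j : ℝ) then coeff φ (truncation φ n S) j ^ 2 else 0) ≤
        coeff φ S j ^ 2 := fun j => by
      rw [coeff_truncation hφ]
      split_ifs <;> simp [sq_nonneg]
    have hnn : ∀ j : ℕ+, 0 ≤ if t < (j : ℝ) then coeff φ (truncation φ n S) j ^ 2 else 0 :=
      fun j => by split_ifs <;> positivity
    have hS := summable_coeff_sq hφ S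
    exact mul_le_mul (by gcongr)
      (((Summable.of_nonneg_of_le hnn hle hS).tsum_le_tsum hle hS).trans (tsum_coeff_sq_le hφ S))
      (tsum_nonneg hnn) (by positivity)
  · have hzero : ∀ j : ℕ+, (if t < (j : ℝ) then coeff φ (truncation φ n S) j ^ 2 else 0) = 0 := by
      intro j
      rw [ite_eq_right_iff, coeff_truncation hφ]
      intro htj
      rw [if_neg fun hjn => (htn.trans_lt htj).not_ge (by exact_mod_cast hjn),
        zero_pow two_ne_zero]
    simp only [hzero, tsum_zero, mul_zero]
    positivity

end Truncation

section Weight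

theorem natCast_mul_le_tsum_of_antitone {f : ℕ+ → ℝ} (hf : Antitone f) (hf₀ : ∀ j, 0 ≤ f j)
    (hs : Summable f) (n : ℕ+) : n * f n ≤ ∑' j, f j := by
  have hcard := Finset.card_nsmul_le_sum (Finset.Icc 1 n) f (f n) fun j hj =>
    hf (Finset.mem_Icc.1 hj).2
  rw [PNat.card_Icc, nsmul_eq_mul] at hcard
  refine le_trans ?_ (hcard.trans (hs.sum_le_tsum _ fun j _ => hf₀ j))
  simp

/-- The weights `κ_{εj}² / (ε² (2 A_ε)^{1/2})` of the normalised test statistic; their squares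
sum to `1 / 2`. -/
def weight (κ : ℝ → ℕ → ℝ) (ε : ℝ) (j : ℕ+) : ℝ := κ ε j ^ 2 / (ε ^ 2 * √(2 * A κ ε))

variable {κ : ℝ → ℕ → ℝ} {ε : ℝ}

theorem weight_nonneg (κ : ℝ → ℕ → ℝ) (ε : ℝ) (j : ℕ+) : 0 ≤ weight κ ε j := by
  unfold weight; positivity

theorem summable_weight (hκ : WeightsSummable κ) (hε : 0 < ε) : Summable (weight κ ε) :=
  (hκ ε hε).div_const _

theorem antitone_weight (hA1 : CondA1 κ) (hε : 0 < ε) : Antitone (weight κ ε) := fun i j hij =>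
  div_le_div_of_nonneg_right (hA1 ε hε (Set.mem_Ici.2 i.pos) (Set.mem_Ici.2 j.pos) hij)
    (by positivity)

theorem weight_le_weight_one (hA1 : CondA1 κ) (hε : 0 < ε) (j : ℕ+) :
    weight κ ε j ≤ weight κ ε 1 :=
  antitone_weight hA1 hε one_le

theorem hasSum_weight_sq (hε : 0 < ε) (hA : 0 < A κ ε) :
    HasSum (fun j => weight κ ε j ^ 2) (1 / 2) := by
  have hs : Summable fun j : ℕ+ => κ ε j ^ 4 := by
    by_contra hns
    rw [A, tsum_eq_zero_of_not_summable hns, mul_zero] at hA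
    exact hA.false
  have hsum : ∑' j : ℕ+, κ ε j ^ 4 = A κ ε * ε ^ 4 := by
    rw [A]
    field_simp
  have hsq : √(2 * A κ ε) ^ 2 = 2 * A κ ε := Real.sq_sqrt (by positivity)
  have hval : (∑' j : ℕ+, κ ε j ^ 4) / (ε ^ 2 * √(2 * A κ ε)) ^ 2 = 1 / 2 := by
    rw [hsum, mul_pow, hsq]
    field_simp
  have hweight : (fun j => weight κ ε j ^ 2) =
      fun j : ℕ+ => κ ε j ^ 4 / (ε ^ 2 * √(2 * A κ ε)) ^ 2 := by
    funext j
    rw [weight, div_pow]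
    ring
  exact hweight ▸ hval ▸ hs.hasSum.div_const _

theorem CondA2.pos (hA2 : CondA2 κ) (hε : 0 < ε) : 0 < A κ ε := by
  obtain ⟨C₁, C₂, hC₁, hA⟩ := hA2
  exact hC₁.trans (hA ε hε).1

theorem weight_le_rpow (hA1 : CondA1 κ) (hA2 : CondA2 κ) (hε : 0 < ε) {K e : ℝ} (hK : 0 < K)
    {j : ℕ+} (hj : K * ε ^ (-2 * e) ≤ j) : weight κ ε j ≤ (√(2 * K))⁻¹ * ε ^ e := by
  have hq := hasSum_weight_sq hε (hA2.pos hε)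
  have hdecay : j * weight κ ε j ^ 2 ≤ 1 / 2 := by
    rw [← hq.tsum_eq]
    refine natCast_mul_le_tsum_of_antitone (fun i k hik => ?_) (fun k => sq_nonneg _) hq.summable j
    exact pow_le_pow_left₀ (weight_nonneg κ ε k) (antitone_weight hA1 hε hik) 2
  have hcancel : ε ^ (-2 * e) * (ε ^ e) ^ 2 = 1 := by
    rw [← Real.rpow_mul_natCast hε.le, ← Real.rpow_add hε]
    norm_num [mul_comm]
  refine le_of_sq_le_sq ?_ (by positivity)
  rw [mul_pow, inv_pow, Real.sq_sqrt (by positivity), inv_mul_eq_div, le_div_iff₀ (by positivity)]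
  calc weight κ ε j ^ 2 * (2 * K)
      = 2 * (K * ε ^ (-2 * e) * weight κ ε j ^ 2) * (ε ^ e) ^ 2 := by
        linear_combination (-(2 * K * weight κ ε j ^ 2)) * hcancel
    _ ≤ 2 * (j * weight κ ε j ^ 2) * (ε ^ e) ^ 2 := by gcongr
    _ ≤ 2 * (1 / 2) * (ε ^ e) ^ 2 := by gcongr
    _ = (ε ^ e) ^ 2 := by ring

theorem isBigO_weight_one (hA1 : CondA1 κ) (hA2 : CondA2 κ)
    (hκ₁ : (fun ε => κ ε 1 ^ 2) =O[𝓝[>] (0 : ℝ)] fun ε => kappaSq κ ε) {e : ℝ}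
    (hk : (fun ε => ε ^ (-2 * e)) =O[𝓝[>] (0 : ℝ)] fun ε => (kEff κ ε : ℝ)) :
    (fun ε => weight κ ε 1) =O[𝓝[>] (0 : ℝ)] fun ε => ε ^ e := by
  obtain ⟨C, hC, hCk⟩ := hk.exists_pos
  obtain ⟨M, hM, hMκ⟩ := hκ₁.exists_pos
  refine IsBigO.of_bound (M * (√(2 * C⁻¹))⁻¹) ?_
  filter_upwards [hCk.bound, hMκ.bound, self_mem_nhdsWithin] with ε hkε hκε hε
  replace hε : 0 < ε := hε
  have hκsq : 0 ≤ kappaSq κ ε := sq_nonneg _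
  rw [Real.norm_of_nonneg (by positivity), Real.norm_of_nonneg (by positivity),
    ← inv_mul_le_iff₀ hC] at hkε
  rw [Real.norm_of_nonneg (by positivity), Real.norm_of_nonneg hκsq] at hκε
  have hkpos : 0 < kEff κ ε := by
    have : 0 < C⁻¹ * ε ^ (-2 * e) := by positivity
    exact_mod_cast this.trans_le hkε
  rw [Real.norm_of_nonneg (weight_nonneg κ ε 1), Real.norm_of_nonneg (by positivity), mul_assoc]
  calc weight κ ε 1 ≤ M * weight κ ε ⟨kEff κ ε, hkpos⟩ := by
        unfold weight
        rw [← mul_div_assoc]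
        exact div_le_div_of_nonneg_right hκε (by positivity)
    _ ≤ M * ((√(2 * C⁻¹))⁻¹ * ε ^ e) := by
        gcongr
        exact weight_le_rpow hA1 hA2 hε (inv_pos.2 hC) hkε

end Weight

section Statistic

variable {φ : ℕ+ → L2} {κ : ℝ → ℕ → ℝ} {ε x : ℝ}

theorem B_eq_tsum (φ : ℕ+ → L2) (κ : ℝ → ℕ → ℝ) (ε : ℝ) (S : L2) :
    B φ κ ε S = ∑' j, weight κ ε j * (coeff φ S j / ε) ^ 2 := by
  rw [B, D, mul_div_right_comm, ← tsum_mul_left]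
  refine tsum_congr fun j => ?_
  simp only [weight, div_eq_mul_inv, mul_inv]
  ring

theorem B_nonneg (φ : ℕ+ → L2) (κ : ℝ → ℕ → ℝ) (ε : ℝ) (S : L2) : 0 ≤ B φ κ ε S := by
  rw [B_eq_tsum]
  exact tsum_nonneg fun j => mul_nonneg (weight_nonneg κ ε j) (sq_nonneg _)

theorem B_zero (φ : ℕ+ → L2) (κ : ℝ → ℕ → ℝ) (ε : ℝ) : B φ κ ε 0 = 0 := by
  simp [B, D, coeff]

theorem summable_weight_mul_sq (hφ : Orthonormal ℝ φ) (hA1 : CondA1 κ) (hε : 0 < ε) (S : L2) :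
    Summable fun j => weight κ ε j * (coeff φ S j / ε) ^ 2 := by
  refine Summable.of_nonneg_of_le (fun j => mul_nonneg (weight_nonneg κ ε j) (sq_nonneg _))
    (fun j => mul_le_mul_of_nonneg_right (weight_le_weight_one hA1 hε j) (sq_nonneg _)) ?_
  simp only [div_pow]
  exact ((summable_coeff_sq hφ S).div_const _).mul_left _

theorem B_le_mul_norm_sq (hφ : Orthonormal ℝ φ) (hA1 : CondA1 κ) (hε : 0 < ε) {S : L2} {W : ℝ}
    (hW₀ : 0 ≤ W) (hW : ∀ j, coeff φ S j ≠ 0 → weight κ ε j ≤ W) :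
    B φ κ ε S ≤ W * (‖S‖ / ε) ^ 2 := by
  have hle : ∀ j, weight κ ε j * (coeff φ S j / ε) ^ 2 ≤ W / ε ^ 2 * coeff φ S j ^ 2 := fun j => by
    rcases eq_or_ne (coeff φ S j) 0 with h₀ | h₀
    · simp [h₀]
    · rw [div_pow, div_mul_eq_mul_div, mul_div_assoc]
      exact mul_le_mul_of_nonneg_right (hW j h₀) (by positivity)
  calc B φ κ ε S ≤ ∑' j, W / ε ^ 2 * coeff φ S j ^ 2 :=
        B_eq_tsum φ κ ε S ▸ (summable_weight_mul_sq hφ hA1 hε S).tsum_le_tsum hle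
          ((summable_coeff_sq hφ S).mul_left _)
    _ ≤ W / ε ^ 2 * ‖S‖ ^ 2 := by
        rw [tsum_mul_left]
        gcongr
        exact tsum_coeff_sq_le hφ S
    _ = W * (‖S‖ / ε) ^ 2 := by ring

theorem B_truncation_add_B_sub_truncation (hφ : Orthonormal ℝ φ) (hA1 : CondA1 κ) (hε : 0 < ε)
    (n : ℕ) (S : L2) :
    B φ κ ε (truncation φ n S) + B φ κ ε (S - truncation φ n S) = B φ κ ε S := by
  simp only [B_eq_tsum]
  rw [← (summable_weight_mul_sq hφ hA1 hε _).tsum_add (summable_weight_mul_sq hφ hA1 hε _)]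
  refine tsum_congr fun j => ?_
  rw [coeff_truncation hφ, coeff_sub_truncation hφ]
  split_ifs <;> simp

theorem B_sub_statistic_eq_deficit (hφ : Orthonormal ℝ φ) (hκ : WeightsSummable κ)
    (hA1 : CondA1 κ) (hε : 0 < ε) (S : L2) (ξ : ℕ+ → ℝ) :
    B φ κ ε S - (ε ^ 2)⁻¹ * T κ ε (obs φ ε S ξ) / √(2 * A κ ε) =
      deficit (weight κ ε) (fun j => coeff φ S j / ε) ξ := by
  have hmean : ∑' j, weight κ ε j * (1 + (coeff φ S j / ε) ^ 2) =
      rhoSq κ ε / (ε ^ 2 * √(2 * A κ ε)) + B φ κ ε S := by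
    simp only [mul_add, mul_one]
    rw [(summable_weight hκ hε).tsum_add (summable_weight_mul_sq hφ hA1 hε S), B_eq_tsum, rhoSq,
      ← tsum_div_const]
    rfl
  have hquad : ∑' j, weight κ ε j * (coeff φ S j / ε + ξ j) ^ 2 =
      (∑' j : ℕ+, κ ε j ^ 2 * obs φ ε S ξ j ^ 2) / (ε ^ 2 * (ε ^ 2 * √(2 * A κ ε))) := by
    rw [← tsum_div_const]
    refine tsum_congr fun j => ?_
    rw [weight, obs, show coeff φ S j / ε + ξ j = (coeff φ S j + ε * ξ j) / ε by field_simp]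
    simp only [div_eq_mul_inv, mul_inv]
    ring
  rw [deficit, hmean, hquad, T]
  simp only [div_eq_mul_inv, mul_inv]
  ring

theorem setOf_obs_notMem_rejectRegion (hφ : Orthonormal ℝ φ) (hκ : WeightsSummable κ)
    (hA1 : CondA1 κ) (hε : 0 < ε) (x : ℝ) (S : L2) :
    {ξ | obs φ ε S ξ ∉ rejectRegion κ ε x} =
      {ξ | B φ κ ε S - x ≤ deficit (weight κ ε) (fun j => coeff φ S j / ε) ξ} := by
  ext ξ
  simp only [rejectRegion, Set.mem_ofPred_eq, not_lt, ← B_sub_statistic_eq_deficit hφ hκ hA1 hε,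
    sub_le_sub_iff_left]

theorem toReal_typeII_eq (hφ : Orthonormal ℝ φ) (hκ : WeightsSummable κ) (hA1 : CondA1 κ)
    (hε : 0 < ε) (x : ℝ) (S : L2) : (typeII φ κ ε x S).toReal = (iidGaussian ℕ+).real
      {ξ | B φ κ ε S - x ≤ deficit (weight κ ε) (fun j => coeff φ S j / ε) ξ} := by
  rw [typeII, setOf_obs_notMem_rejectRegion hφ hκ hA1 hε]
  rfl

theorem toReal_typeI_eq (hφ : Orthonormal ℝ φ) (hκ : WeightsSummable κ) (hA1 : CondA1 κ)
    (hε : 0 < ε) (x : ℝ) : (typeI φ κ ε x).toReal = 1 - (typeII φ κ ε x 0).toReal := by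
  have hmeas : MeasurableSet {ξ | obs φ ε 0 ξ ∉ rejectRegion κ ε x} := by
    rw [setOf_obs_notMem_rejectRegion hφ hκ hA1 hε]
    exact measurableSet_le measurable_const measurable_deficit
  change (iidGaussian ℕ+).real {ξ | obs φ ε 0 ξ ∈ rejectRegion κ ε x} =
    1 - (iidGaussian ℕ+).real {ξ | obs φ ε 0 ξ ∉ rejectRegion κ ε x}
  rw [← probReal_compl_eq_one_sub hmeas]
  congr 1
  ext ξ
  simp only [Set.mem_compl_iff, Set.mem_ofPred_eq, not_not]

theorem monotone_typeII (φ : ℕ+ → L2) (κ : ℝ → ℕ → ℝ) (ε : ℝ) (S : L2) :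
    Monotone fun x => typeII φ κ ε x S := fun _ _ hxy =>
  measure_mono fun _ hξ hrej => hξ (hxy.trans_lt hrej)

theorem typeII_le_one (φ : ℕ+ → L2) (κ : ℝ → ℕ → ℝ) (ε x : ℝ) (S : L2) :
    typeII φ κ ε x S ≤ 1 :=
  prob_le_one (μ := iidGaussian ℕ+)

theorem toReal_typeII_le (hφ : Orthonormal ℝ φ) (hκ : WeightsSummable κ) (hA1 : CondA1 κ)
    (hA2 : CondA2 κ) (hε : 0 < ε) {S : L2} (hx : x ≤ B φ κ ε S) : (typeII φ κ ε x S).toReal ≤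
      Real.exp (-((1 - 4 * (weight κ ε 1 * B φ κ ε S)) * ((B φ κ ε S - x) ^ 2 / 2))) := by
  have htail := measureReal_le_deficit_le (weight_nonneg κ ε) (weight_le_weight_one hA1 hε)
    (summable_weight hκ hε) (hasSum_weight_sq hε (hA2.pos hε))
    (summable_weight_mul_sq hφ hA1 hε S) (sub_nonneg.2 hx)
  rwa [← B_eq_tsum, ← toReal_typeII_eq hφ hκ hA1 hε] at htail

theorem exp_neg_le_toReal_typeII (hφ : Orthonormal ℝ φ) (hκ : WeightsSummable κ)
    (hA1 : CondA1 κ) (hA2 : CondA2 κ) (hε : 0 < ε) {S : L2} {τ : ℝ} (hτ : 0 < τ) (hτ₁ : τ ≤ 1)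
    (hx : x ≤ B φ κ ε S) (hxτ : 8 ≤ (τ * (B φ κ ε S - x)) ^ 2)
    (hwx : 416 * (weight κ ε 1 * (B φ κ ε S - x)) ≤ τ ^ 2)
    (hwB : 104 * (weight κ ε 1 * B φ κ ε S) ≤ τ ^ 2) :
    Real.exp (-((1 + 10 * τ) * ((B φ κ ε S - x) ^ 2 / 2))) ≤ (typeII φ κ ε x S).toReal := by
  rw [toReal_typeII_eq hφ hκ hA1 hε]
  exact exp_neg_le_measureReal_le_deficit (weight_nonneg κ ε) (weight_le_weight_one hA1 hε)
    (summable_weight hκ hε) (hasSum_weight_sq hε (hA2.pos hε))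
    (summable_weight_mul_sq hφ hA1 hε S) hτ hτ₁ (sub_nonneg.2 hx) hxτ hwx (B_eq_tsum φ κ ε S ▸ hwB)

theorem half_le_toReal_typeI (hφ : Orthonormal ℝ φ) (hκ : WeightsSummable κ) (hA1 : CondA1 κ)
    (hA2 : CondA2 κ) (hε : 0 < ε) (hx : x ≤ -2) : 1 / 2 ≤ (typeI φ κ ε x).toReal := by
  have hB := B_zero φ κ ε
  have htypeII := toReal_typeII_le hφ hκ hA1 hA2 hε (S := 0) (x := x) (by linarith)
  have hexp : Real.exp (-((1 - 4 * (weight κ ε 1 * B φ κ ε 0)) * ((B φ κ ε 0 - x) ^ 2 / 2))) ≤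
      Real.exp (-2) := by
    rw [hB, Real.exp_le_exp]
    nlinarith
  rw [toReal_typeI_eq hφ hκ hA1 hε]
  linarith [exp_neg_two_le]

end Statistic

section AbsLog

variable {p q : ℝ≥0∞} {L L' : ℝ}

theorem exists_log_eq_neg (hp : p.toReal ∈ Set.Icc (Real.exp (-L')) (Real.exp (-L))) :
    ∃ l ∈ Set.Icc L L', ENNReal.log p = (-l : ℝ) := by
  have hp₀ : 0 < p.toReal := (Real.exp_pos _).trans_le hp.1
  refine ⟨-Real.log p.toReal, ⟨?_, ?_⟩, ?_⟩
  · exact le_neg.2 ((Real.log_le_iff_le_exp hp₀).2 hp.2)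
  · exact neg_le.2 ((Real.le_log_iff_exp_le hp₀).2 hp.1)
  · rw [neg_neg, ENNReal.log_pos_real' hp₀]

theorem absLog_of_log_eq_neg (hL : 0 ≤ L) (hp : ENNReal.log p = (-L : ℝ)) :
    absLog p = ENNReal.ofReal L := by
  rw [absLog, hp, EReal.abs_def, abs_neg, abs_of_nonneg hL]

theorem absLog_le_absLog (hpq : p ≤ q) (hq : q ≤ 1) : absLog q ≤ absLog p := by
  have hlog : ENNReal.log p ≤ ENNReal.log q := ENNReal.log_monotone hpq
  have hq₀ : ENNReal.log q ≤ 0 := ENNReal.log_one ▸ ENNReal.log_monotone hq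
  unfold absLog
  generalize ENNReal.log p = u at hlog
  generalize ENNReal.log q = v at hlog hq₀
  induction u with
  | bot => simp
  | top => simp_all
  | coe u =>
    induction v with
    | bot => simp at hlog
    | top => simp at hq₀
    | coe v =>
      rw [EReal.coe_le_coe_iff] at hlog
      rw [← EReal.coe_zero, EReal.coe_le_coe_iff] at hq₀
      rw [EReal.abs_def, EReal.abs_def, abs_of_nonpos hq₀, abs_of_nonpos (hlog.trans hq₀)]
      exact ENNReal.ofReal_le_ofReal (neg_le_neg hlog)

end AbsLog

section Asymptotics

variable {φ : ℕ+ → L2} {κ : ℝ → ℕ → ℝ} {S : ℝ → L2}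

/-- Up to the relative error `τ`, the type II error of a test has the Gaussian exponent `y² / 2`
whenever the threshold lies `y` below the mean `B_ε(S)` and this mean is at most `b`. -/
def HasGaussianTypeII (φ : ℕ+ → L2) (κ : ℝ → ℕ → ℝ) (τ ε b y : ℝ) : Prop :=
  ∀ (x : ℝ) (S : L2), B φ κ ε S - x = y → B φ κ ε S ≤ b →
    ∃ L ∈ Set.Icc ((1 - τ) * (y ^ 2 / 2)) ((1 + τ) * (y ^ 2 / 2)),
      ENNReal.log (typeII φ κ ε x S) = (-L : ℝ)

theorem eventually_hasGaussianTypeII_mul (hφ : Orthonormal ℝ φ) (hκ : WeightsSummable κ)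
    (hA1 : CondA1 κ) (hA2 : CondA2 κ) {y : ℝ → ℝ} (hy : Tendsto y (𝓝[>] 0) atTop)
    (hwy : Tendsto (fun ε => weight κ ε 1 * y ε) (𝓝[>] 0) (𝓝 0)) {τ : ℝ} (hτ : 0 < τ) (K : ℝ) :
    ∀ᶠ ε in 𝓝[>] (0 : ℝ), HasGaussianTypeII φ κ τ ε (K * y ε) (y ε) := by
  set σ := min τ 10 / 10 with hσ
  have hσ₀ : 0 < σ := by positivity
  have hσ₁ : σ ≤ 1 := by linarith [min_le_right τ 10]
  have hστ : 10 * σ ≤ τ := by linarith [min_le_left τ 10]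
  have hsmall : ∀ {c η : ℝ}, 0 < η → ∀ᶠ ε in 𝓝[>] (0 : ℝ), c * (weight κ ε 1 * y ε) ≤ η :=
    fun {c η} hη => (hwy.const_mul c).eventually (eventually_le_nhds (by rwa [mul_zero]))
  filter_upwards [hy.eventually_ge_atTop (3 / σ), hsmall (c := 416) (pow_pos hσ₀ 2),
    hsmall (c := 104 * K) (pow_pos hσ₀ 2), hsmall (c := 4 * K) hτ, self_mem_nhdsWithin]
    with ε hyσ hwyσ hKσ hKτ hε x S hx hBK
  rw [div_le_iff₀' hσ₀] at hyσ
  have hy₀ : 0 ≤ y ε := by nlinarith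
  have hwB : weight κ ε 1 * B φ κ ε S ≤ K * (weight κ ε 1 * y ε) := by
    rw [mul_left_comm]
    exact mul_le_mul_of_nonneg_left hBK (weight_nonneg κ ε 1)
  have hxB : x ≤ B φ κ ε S := by linarith
  have hupper := toReal_typeII_le hφ hκ hA1 hA2 hε hxB
  have hlower := exp_neg_le_toReal_typeII hφ hκ hA1 hA2 hε hσ₀ hσ₁ hxB
    (by rw [hx]; nlinarith) (by rwa [hx]) (by linarith)
  rw [hx] at hupper hlower
  refine exists_log_eq_neg ⟨le_trans ?_ hlower, hupper.trans ?_⟩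
  · rw [Real.exp_le_exp, neg_le_neg_iff]
    gcongr
  · rw [Real.exp_le_exp, neg_le_neg_iff]
    gcongr
    linarith

theorem eventually_hasGaussianTypeII (hφ : Orthonormal ℝ φ) (hκ : WeightsSummable κ)
    (hA1 : CondA1 κ) (hA2 : CondA2 κ) {b y : ℝ → ℝ} {a K : ℝ} (hb : Tendsto b (𝓝[>] 0) atTop)
    (hwb : Tendsto (fun ε => weight κ ε 1 * b ε) (𝓝[>] 0) (𝓝 0)) (ha : 0 < a)
    (hay : ∀ᶠ ε in 𝓝[>] (0 : ℝ), a * b ε ≤ y ε) (hyb : ∀ᶠ ε in 𝓝[>] (0 : ℝ), y ε ≤ K * b ε)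
    {τ : ℝ} (hτ : 0 < τ) :
    ∀ᶠ ε in 𝓝[>] (0 : ℝ), HasGaussianTypeII φ κ τ ε (b ε) (y ε) := by
  have hy : Tendsto y (𝓝[>] 0) atTop := tendsto_atTop_mono' _ hay (hb.const_mul_atTop ha)
  have hwy : Tendsto (fun ε => weight κ ε 1 * y ε) (𝓝[>] 0) (𝓝 0) := by
    have hlim : Tendsto (fun ε => weight κ ε 1 * (K * b ε)) (𝓝[>] 0) (𝓝 0) := by
      simpa only [mul_left_comm, mul_zero] using hwb.const_mul K
    refine tendsto_of_tendsto_of_tendsto_of_le_of_le' tendsto_const_nhds hlim ?_ ?_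
    · filter_upwards [hy.eventually_ge_atTop 0] with ε hy₀
      exact mul_nonneg (weight_nonneg κ ε 1) hy₀
    · filter_upwards [hyb] with ε hyb
      exact mul_le_mul_of_nonneg_left hyb (weight_nonneg κ ε 1)
  filter_upwards [eventually_hasGaussianTypeII_mul hφ hκ hA1 hA2 hy hwy hτ a⁻¹, hay]
    with ε hlog hay x S hx hBb
  exact hlog x S hx (hBb.trans ((le_inv_mul_iff₀ ha).2 hay))

theorem tendsto_absLog_typeI_neg_two_div (hφ : Orthonormal ℝ φ) (hκ : WeightsSummable κ)
    (hA1 : CondA1 κ) (hA2 : CondA2 κ) {R : ℝ → ℝ} (hR : Tendsto R (𝓝[>] 0) atTop) :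
    Tendsto (fun ε => absLog (typeI φ κ ε (-2)) / ENNReal.ofReal (R ε ^ 2)) (𝓝[>] 0) (𝓝 0) := by
  have hlim : Tendsto (fun ε => ENNReal.ofReal (Real.log 2) / ENNReal.ofReal (R ε ^ 2))
      (𝓝[>] 0) (𝓝 0) := by
    rw [← ENNReal.div_top]
    refine ENNReal.Tendsto.const_div ?_ (Or.inr ENNReal.ofReal_ne_top)
    exact ENNReal.tendsto_ofReal_atTop.comp ((tendsto_pow_atTop two_ne_zero).comp hR)
  refine tendsto_of_tendsto_of_tendsto_of_le_of_le' tendsto_const_nhds hlim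
    (Eventually.of_forall fun _ => zero_le) ?_
  filter_upwards [self_mem_nhdsWithin] with ε hε
  have hhalf := half_le_toReal_typeI hφ hκ hA1 hA2 hε le_rfl
  obtain ⟨L, ⟨hL₀, hL⟩, hlog⟩ := exists_log_eq_neg (p := typeI φ κ ε (-2)) (L := 0)
    (L' := Real.log 2) ⟨by rwa [Real.exp_neg, Real.exp_log two_pos, ← one_div],
      by rw [neg_zero, Real.exp_zero]; exact measureReal_le_one (μ := iidGaussian ℕ+)⟩
  rw [absLog_of_log_eq_neg hL₀ hlog]
  gcongr

theorem IsLDConsistent.isBigO_B {R : ℝ → ℝ} (hcons : IsLDConsistent φ κ R S)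
    (hφ : Orthonormal ℝ φ) (hκ : WeightsSummable κ) (hA1 : CondA1 κ) (hA2 : CondA2 κ)
    (hR : Tendsto R (𝓝[>] 0) atTop)
    (hwR : Tendsto (fun ε => weight κ ε 1 * R ε) (𝓝[>] 0) (𝓝 0)) :
    R =O[𝓝[>] 0] fun ε => B φ κ ε (S ε) := by
  obtain ⟨c₀, hc₀, htypeII⟩ := hcons _ (tendsto_absLog_typeI_neg_two_div hφ hκ hA1 hA2 hR)
  set η := √c₀ / 2 with hη
  have hη₀ : 0 < η := by positivity
  have hηsq : η ^ 2 = c₀ / 4 := by rw [hη, div_pow, Real.sq_sqrt hc₀.le]; norm_num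
  have hwηR : Tendsto (fun ε => weight κ ε 1 * (η * R ε)) (𝓝[>] 0) (𝓝 0) := by
    simpa only [mul_left_comm, mul_zero] using hwR.const_mul η
  refine IsBigO.of_bound (2 / η) ?_
  filter_upwards [htypeII, hR.eventually_ge_atTop (4 / η),
    eventually_hasGaussianTypeII_mul hφ hκ hA1 hA2 (hR.const_mul_atTop hη₀) hwηR one_pos 1]
    with ε hbound hRη hlog
  rw [div_le_iff₀' hη₀] at hRη
  have hR₀ : 0 < R ε := pos_of_mul_pos_right (by linarith) hη₀.le
  rw [Real.norm_of_nonneg hR₀.le, Real.norm_of_nonneg (B_nonneg ..), div_mul_eq_mul_div,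
    le_div_iff₀' hη₀]
  by_contra! hB
  obtain ⟨L, ⟨hL₀, hL⟩, hL'⟩ := hlog (B φ κ ε (S ε) - η * R ε) (S ε) (by ring) (by linarith)
  have hle : ENNReal.ofReal (c₀ * R ε ^ 2) ≤ ENNReal.ofReal L := by
    rw [← absLog_of_log_eq_neg (by simpa using hL₀) hL']
    refine hbound.trans (absLog_le_absLog (monotone_typeII φ κ ε (S ε) ?_) (typeII_le_one ..))
    linarith
  rw [ENNReal.ofReal_le_ofReal_iff (by simpa using hL₀)] at hle
  rw [mul_pow, hηsq] at hL
  nlinarith [mul_pos hc₀ (pow_pos hR₀ 2)]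

end Asymptotics

section Admissible

variable {φ : ℕ+ → L2} {κ : ℝ → ℕ → ℝ} {S : ℝ → L2} {c e : ℝ} {x : ℝ → ℝ}

theorem AdmissibleTests.eventually_neg_two_le (hx : AdmissibleTests φ κ c S x)
    (hφ : Orthonormal ℝ φ) (hκ : WeightsSummable κ) (hA1 : CondA1 κ) (hA2 : CondA2 κ) :
    ∀ᶠ ε in 𝓝[>] (0 : ℝ), -2 ≤ x ε := by
  have hlim := (ENNReal.tendsto_toReal ENNReal.zero_ne_top).comp hx.1
  filter_upwards [hlim.eventually (eventually_lt_nhds (show (0 : ℝ) < 1 / 2 by norm_num)),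
    self_mem_nhdsWithin] with ε hhalf hε
  by_contra! hlt
  exact hhalf.not_ge (half_le_toReal_typeI hφ hκ hA1 hA2 hε hlt.le)

theorem isTheta_B_D (φ : ℕ+ → L2) (hA2 : CondA2 κ) (S : ℝ → L2) :
    (fun ε => B φ κ ε (S ε)) =Θ[𝓝[>] (0 : ℝ)] fun ε => D φ κ ε (S ε) := by
  obtain ⟨C₁, C₂, hC₁, hA⟩ := hA2
  refine ⟨IsBigO.of_bound (√(2 * C₁))⁻¹ ?_, IsBigO.of_bound √(2 * C₂) ?_⟩ <;>
    filter_upwards [self_mem_nhdsWithin] with ε hε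
  · rw [B, norm_div, inv_mul_eq_div, Real.norm_of_nonneg (Real.sqrt_nonneg _)]
    gcongr
    exact (hA ε hε).1.le
  · have hA₀ : 0 < A κ ε := hC₁.trans (hA ε hε).1
    rw [B, norm_div, mul_div_left_comm, Real.norm_of_nonneg (Real.sqrt_nonneg _)]
    refine le_mul_of_one_le_right (norm_nonneg _) ((one_le_div (by positivity)).2 ?_)
    gcongr
    exact (hA ε hε).2.le

theorem AdmissibleTests.tendsto_B (hx : AdmissibleTests φ κ c S x) (hA2 : CondA2 κ) :
    Tendsto (fun ε => B φ κ ε (S ε)) (𝓝[>] 0) atTop := by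
  have hD : Tendsto (fun ε => ‖D φ κ ε (S ε)‖) (𝓝[>] 0) atTop :=
    tendsto_norm_atTop_atTop.comp hx.2.1
  refine ((isTheta_B_D φ hA2 S).tendsto_norm_atTop_iff.2 hD).congr fun ε => ?_
  exact Real.norm_of_nonneg (B_nonneg ..)

theorem AdmissibleTests.isLittleO_B (hx : AdmissibleTests φ κ c S x) (hA2 : CondA2 κ)
    (hk : (fun ε => (kEff κ ε : ℝ)) =O[𝓝[>] (0 : ℝ)] fun ε => ε ^ (-2 * e)) :
    (fun ε => B φ κ ε (S ε)) =o[𝓝[>] (0 : ℝ)] fun ε => ε ^ (-e) := by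
  have hpos : ∀ᶠ ε : ℝ in 𝓝[>] 0, 0 < ε := self_mem_nhdsWithin
  have hsqrt : (fun ε => √(kEff κ ε : ℝ)) =O[𝓝[>] (0 : ℝ)] fun ε => ε ^ (-e) := by
    refine (hk.sqrt (hpos.mono fun ε hε => by positivity)).trans_eventuallyEq ?_
    filter_upwards [hpos] with ε hε
    rw [Real.sqrt_eq_rpow, ← Real.rpow_mul hε.le]
    congr 1
    ring
  exact ((isTheta_B_D φ hA2 S).isBigO.trans_isLittleO hx.2.2.1).trans_isBigO hsqrt

theorem tendsto_weight_one_mul_zero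
    (hw : (fun ε => weight κ ε 1) =O[𝓝[>] (0 : ℝ)] fun ε => ε ^ e) {f : ℝ → ℝ}
    (hf : f =o[𝓝[>] 0] fun ε => ε ^ (-e)) :
    Tendsto (fun ε => weight κ ε 1 * f ε) (𝓝[>] 0) (𝓝 0) := by
  refine (isLittleO_one_iff ℝ).1 ((hw.mul_isLittleO hf).trans_eventuallyEq ?_)
  filter_upwards [self_mem_nhdsWithin] with ε hε
  rw [← Real.rpow_add hε, add_neg_cancel, Real.rpow_zero]

end Admissible

section Comparison

theorem abs_sub_le_and_le_of_mem_Icc {y y₁ τ δ L L₁ L₂ : ℝ} (hτ : 0 < τ) (hτ₁ : τ ≤ 1 / 4)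
    (hδ : 6 * τ ≤ δ) (hy : 0 ≤ y) (hyy₁ : (1 - τ) * y ≤ y₁) (hy₁y : y₁ ≤ y)
    (hL : L ∈ Set.Icc ((1 - τ) * (y ^ 2 / 2)) ((1 + τ) * (y ^ 2 / 2)))
    (hL₁ : L₁ ∈ Set.Icc ((1 - τ) * (y₁ ^ 2 / 2)) ((1 + τ) * (y₁ ^ 2 / 2)))
    (hL₂ : L₂ ≤ (1 + τ) * ((2 * τ * y) ^ 2 / 2)) : |L - L₁| ≤ δ * L ∧ L₂ ≤ δ * L := by
  have hτy : 0 ≤ (1 - τ) * y := mul_nonneg (by linarith) hy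
  have hlower : (1 - 2 * τ) * y ^ 2 ≤ y₁ ^ 2 := by
    nlinarith [pow_le_pow_left₀ hτy hyy₁ 2, sq_nonneg (τ * y)]
  have hupper : y₁ ^ 2 ≤ y ^ 2 := pow_le_pow_left₀ (hτy.trans hyy₁) hy₁y 2
  have hδL : 6 * τ * (3 / 8 * y ^ 2) ≤ δ * L :=
    mul_le_mul hδ (by nlinarith [hL.1, sq_nonneg y]) (by positivity) (by linarith)
  have hL₁' : (1 - τ) * ((1 - 2 * τ) * y ^ 2 / 2) ≤ L₁ := by
    nlinarith [hL₁.1]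
  have hττ : 0 ≤ τ * τ * y ^ 2 := by positivity
  have hτττ : τ * τ * y ^ 2 ≤ τ / 4 * y ^ 2 := by gcongr; nlinarith
  refine ⟨abs_sub_le_iff.2 ⟨?_, ?_⟩, ?_⟩
  · nlinarith [hL.2]
  · nlinarith [hL.1, hL₁.2]
  · nlinarith [mul_nonneg hτ.le hττ]

variable {φ : ℕ+ → L2} {κ : ℝ → ℕ → ℝ} {c τ δ : ℝ}

/-- The signals `S` and `S₁` have comparable type II errors, and the type II error of `S - S₁` is
exponentially larger, all up to the fraction `δ` of the exponent belonging to `S`. -/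
def IsTypeIIApprox (φ : ℕ+ → L2) (κ : ℝ → ℕ → ℝ) (δ ε x : ℝ) (S S₁ : L2) : Prop :=
  (ENNReal.log (typeII φ κ ε x S) - ENNReal.log (typeII φ κ ε x S₁)).abs ≤
      ENNReal.ofReal δ * absLog (typeII φ κ ε x S) ∧
    absLog (typeII φ κ ε x (S - S₁)) ≤ ENNReal.ofReal δ * absLog (typeII φ κ ε x S)

theorem isTypeIIApprox_of_hasGaussianTypeII {ε x : ℝ} {S S₁ : L2} (hτ : 0 < τ) (hτ₁ : τ ≤ 1 / 4)
    (hδ : 6 * τ ≤ δ) (hx : x ≤ B φ κ ε S)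
    (hadd : B φ κ ε S₁ + B φ κ ε (S - S₁) = B φ κ ε S)
    (hsub : B φ κ ε (S - S₁) ≤ τ * (B φ κ ε S - x))
    (hsub' : B φ κ ε (S - S₁) - x ≤ 2 * τ * (B φ κ ε S - x))
    (hlog : HasGaussianTypeII φ κ τ ε (B φ κ ε S) (B φ κ ε S - x))
    (hlog₁ : HasGaussianTypeII φ κ τ ε (B φ κ ε S) (B φ κ ε S₁ - x))
    (hlog₂ : HasGaussianTypeII φ κ τ ε (B φ κ ε S) (2 * τ * (B φ κ ε S - x))) :
    IsTypeIIApprox φ κ δ ε x S S₁ := by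
  have hB₁ := B_nonneg φ κ ε S₁
  have hB₂ := B_nonneg φ κ ε (S - S₁)
  set y := B φ κ ε S - x
  have hy₀ : 0 ≤ y := sub_nonneg.2 hx
  obtain ⟨L, hL, hlogL⟩ := hlog x S rfl le_rfl
  obtain ⟨L₁, hL₁, hlogL₁⟩ := hlog₁ x S₁ rfl (by linarith)
  obtain ⟨L₂, hL₂, hlogL₂⟩ :=
    hlog₂ (B φ κ ε (S - S₁) - 2 * τ * y) (S - S₁) (by ring) (by linarith)
  have hL₀ : 0 ≤ L := (mul_nonneg (by linarith) (by positivity)).trans hL.1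
  have hL₂₀ : 0 ≤ L₂ := (mul_nonneg (by linarith) (by positivity)).trans hL₂.1
  obtain ⟨hdiff, hrest⟩ := abs_sub_le_and_le_of_mem_Icc hτ hτ₁ hδ hy₀ (by linarith)
    (by linarith) hL hL₁ hL₂.2
  rw [IsTypeIIApprox, absLog_of_log_eq_neg hL₀ hlogL, ← ENNReal.ofReal_mul (by linarith)]
  constructor
  · rw [hlogL, hlogL₁, ← EReal.coe_sub, EReal.abs_def, neg_sub_neg, abs_sub_comm]
    exact ENNReal.ofReal_le_ofReal hdiff
  · calc absLog (typeII φ κ ε x (S - S₁))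
        ≤ absLog (typeII φ κ ε (B φ κ ε (S - S₁) - 2 * τ * y) (S - S₁)) :=
          absLog_le_absLog (monotone_typeII φ κ ε _ (by linarith)) (typeII_le_one ..)
      _ = ENNReal.ofReal L₂ := absLog_of_log_eq_neg hL₂₀ hlogL₂
      _ ≤ ENNReal.ofReal (δ * L) := ENNReal.ofReal_le_ofReal hrest

theorem AdmissibleTests.eventually_isTypeIIApprox {S S₁ : ℝ → L2} {x : ℝ → ℝ}
    (hx : AdmissibleTests φ κ c S x) (hφ : Orthonormal ℝ φ)
    (hκ : WeightsSummable κ) (hA1 : CondA1 κ) (hA2 : CondA2 κ) (hc : 0 < c)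
    (hwB : Tendsto (fun ε => weight κ ε 1 * B φ κ ε (S ε)) (𝓝[>] 0) (𝓝 0))
    (hadd : ∀ᶠ ε in 𝓝[>] (0 : ℝ),
      B φ κ ε (S₁ ε) + B φ κ ε (S ε - S₁ ε) = B φ κ ε (S ε))
    (hsub : ∀ᶠ ε in 𝓝[>] (0 : ℝ), B φ κ ε (S ε - S₁ ε) ≤ τ * c * B φ κ ε (S ε))
    (hτ : 0 < τ) (hτ₁ : τ ≤ 1 / 4) (hδ : 6 * τ ≤ δ) :
    ∀ᶠ ε in 𝓝[>] (0 : ℝ), IsTypeIIApprox φ κ δ ε (x ε) (S ε) (S₁ ε) := by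
  have hB := hx.tendsto_B hA2
  have hcB := hx.2.2.2
  have hτc : 0 < τ * c := mul_pos hτ hc
  have hx₂ := hx.eventually_neg_two_le hφ hκ hA1 hA2
  have hgap : ∀ᶠ ε in 𝓝[>] (0 : ℝ), B φ κ ε (S ε) - x ε ≤ 2 * B φ κ ε (S ε) := by
    filter_upwards [hB.eventually_ge_atTop 2, hx₂] with ε hB₂ hx₂
    linarith
  have hlog := eventually_hasGaussianTypeII hφ hκ hA1 hA2 hB hwB hc hcB hgap hτ
  have hlog₁ := eventually_hasGaussianTypeII hφ hκ hA1 hA2 hB hwB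
    (y := fun ε => B φ κ ε (S₁ ε) - x ε) (a := (1 - τ) * c) (K := 2) (by nlinarith)
    (by filter_upwards [hadd, hsub, hcB] with ε hadd hsub hcB; linarith)
    (by filter_upwards [hgap, hadd] with ε hgap hadd; linarith [B_nonneg φ κ ε (S ε - S₁ ε)]) hτ
  have hlog₂ := eventually_hasGaussianTypeII hφ hκ hA1 hA2 hB hwB
    (y := fun ε => 2 * τ * (B φ κ ε (S ε) - x ε)) (a := 2 * τ * c) (K := 4 * τ) (by positivity)
    (by filter_upwards [hcB] with ε hcB; nlinarith)
    (by filter_upwards [hgap] with ε hgap; nlinarith) hτ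
  filter_upwards [hadd, hsub, hcB, hx₂, hB.eventually_ge_atTop (2 / (τ * c)),
    hB.eventually_ge_atTop 0, hlog, hlog₁, hlog₂]
    with ε hadd hsub hcB hx₂ hBτc hB₀ hlog hlog₁ hlog₂
  rw [div_le_iff₀' hτc] at hBτc
  have hτcB : τ * c * B φ κ ε (S ε) ≤ τ * (B φ κ ε (S ε) - x ε) := by
    rw [mul_assoc]; gcongr
  exact isTypeIIApprox_of_hasGaussianTypeII hτ hτ₁ hδ (by linarith [mul_nonneg hc.le hB₀]) hadd
    (hsub.trans hτcB) (by linarith) hlog hlog₁ hlog₂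

end Comparison

section TruncationLevel

theorem isLittleO_rpow_rpow_nhdsGT_zero {p q : ℝ} (hpq : p < q) :
    (fun ε : ℝ => ε ^ q) =o[𝓝[>] 0] fun ε => ε ^ p := by
  have hlim : Tendsto (fun ε : ℝ => ε ^ (q - p)) (𝓝[>] 0) (𝓝 0) := by
    have hcont := Real.continuousAt_rpow_const 0 (q - p) (Or.inr (sub_nonneg.2 hpq.le))
    rw [ContinuousAt, Real.zero_rpow (sub_ne_zero.2 hpq.ne')] at hcont
    exact hcont.mono_left nhdsWithin_le_nhds
  have hmul := ((isLittleO_one_iff ℝ).2 hlim).mul_isBigO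
    (isBigO_refl (fun ε : ℝ => ε ^ p) (𝓝[>] 0))
  simp only [one_mul] at hmul
  refine EventuallyEq.trans_isLittleO ?_ hmul
  filter_upwards [self_mem_nhdsWithin] with ε hε
  rw [← Real.rpow_add hε, sub_add_cancel]

theorem natCeil_rpow_mul_sq_le {ε a e t K M : ℝ} (hε : 0 < ε) (hε₁ : ε ≤ 1) (he : 0 ≤ e)
    (ht : 0 ≤ t) (hK : 0 ≤ K) (ha : |a| ≤ M * ε ^ (e * t)) :
    (⌈K * ε ^ (-2 * e)⌉₊ : ℝ) ^ t * a ^ 2 ≤ (K + 1) ^ t * M ^ 2 := by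
  have hceil : (⌈K * ε ^ (-2 * e)⌉₊ : ℝ) ≤ (K + 1) * ε ^ (-2 * e) := by
    have hone := Real.one_le_rpow_of_pos_of_le_one_of_nonpos hε hε₁ (by linarith : -2 * e ≤ 0)
    linarith [Nat.ceil_lt_add_one (show 0 ≤ K * ε ^ (-2 * e) by positivity)]
  have hcancel : (ε ^ (-2 * e)) ^ t * (ε ^ (e * t)) ^ 2 = 1 := by
    rw [← Real.rpow_mul hε.le, ← Real.rpow_mul_natCast hε.le, ← Real.rpow_add hε,
      Nat.cast_ofNat, show -2 * e * t + e * t * 2 = 0 by ring, Real.rpow_zero]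
  calc (⌈K * ε ^ (-2 * e)⌉₊ : ℝ) ^ t * a ^ 2
      ≤ ((K + 1) * ε ^ (-2 * e)) ^ t * (M * ε ^ (e * t)) ^ 2 := by
        gcongr ?_ ^ t * ?_
        exact sq_le_sq' (abs_le.1 ha).1 (abs_le.1 ha).2
    _ = (K + 1) ^ t * M ^ 2 * ((ε ^ (-2 * e)) ^ t * (ε ^ (e * t)) ^ 2) := by
        rw [Real.mul_rpow (by positivity) (by positivity)]
        ring
    _ = (K + 1) ^ t * M ^ 2 := by rw [hcancel, mul_one]

theorem exists_level_rpow_mul_sq_le {f : ℝ → ℝ} {e t K : ℝ} (he : 0 ≤ e) (ht : 0 < t)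
    (hK : 0 ≤ K) (hf : f =O[𝓝[>] 0] fun ε => ε ^ (e * t)) :
    ∃ n : ℝ → ℕ, (∀ᶠ ε in 𝓝[>] (0 : ℝ), K * ε ^ (-2 * e) ≤ n ε) ∧
      ∃ P > 0, ∀ ε > 0, (n ε : ℝ) ^ t * f ε ^ 2 ≤ P := by
  obtain ⟨M, hM, hfM⟩ := hf.exists_pos
  have hlt_one : ∀ᶠ ε in 𝓝[>] (0 : ℝ), ε < 1 :=
    (eventually_lt_nhds one_pos).filter_mono nhdsWithin_le_nhds
  obtain ⟨ε₁, hε₁, hsub⟩ := mem_nhdsGT_iff_exists_Ioo_subset.1 (hfM.bound.and hlt_one)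
  refine ⟨fun ε => if ε < ε₁ then ⌈K * ε ^ (-2 * e)⌉₊ else 0, ?_, (K + 1) ^ t * M ^ 2,
    by positivity, fun ε hε => ?_⟩
  · filter_upwards [Ioo_mem_nhdsGT hε₁] with ε hε
    rw [if_pos hε.2]
    exact Nat.le_ceil _
  beta_reduce
  split_ifs with hεε₁
  · obtain ⟨hfε, hε₂⟩ := hsub ⟨hε, hεε₁⟩
    rw [Real.norm_of_nonneg (by positivity : (0 : ℝ) ≤ ε ^ (e * t))] at hfε
    exact natCeil_rpow_mul_sq_le hε (le_of_lt hε₂) he ht.le hK hfε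
  · rw [Nat.cast_zero, Real.zero_rpow ht.ne', zero_mul]
    positivity

theorem rpow_mul_div_sq {ε : ℝ} (hε : 0 < ε) (e q : ℝ) :
    ε ^ e * (ε ^ q / ε) ^ 2 = ε ^ (e + 2 * q - 2) := by
  rw [← Real.rpow_sub_one hε.ne', ← Real.rpow_mul_natCast hε.le, ← Real.rpow_add hε,
    Nat.cast_ofNat]
  congr 1
  ring

variable {φ : ℕ+ → L2} {κ : ℝ → ℕ → ℝ} {S S₁ : ℝ → L2} {e q : ℝ}

theorem exists_level_B_sub_truncation_le (hφ : Orthonormal ℝ φ) (hA1 : CondA1 κ)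
    (hA2 : CondA2 κ) (hS : (fun ε => ‖S ε‖) =O[𝓝[>] 0] fun ε => ε ^ q)
    (hB : (fun ε => ε ^ (e + 2 * q - 2)) =O[𝓝[>] 0] fun ε => B φ κ ε (S ε)) {η : ℝ}
    (hη : 0 < η) :
    ∃ K > 0, ∀ n : ℝ → ℕ, (∀ᶠ ε in 𝓝[>] (0 : ℝ), K * ε ^ (-2 * e) ≤ n ε) →
      ∀ᶠ ε in 𝓝[>] (0 : ℝ),
        B φ κ ε (S ε - truncation φ (n ε) (S ε)) ≤ η * B φ κ ε (S ε) := by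
  obtain ⟨M, hM, hSM⟩ := hS.exists_pos
  obtain ⟨b, hb, hBb⟩ := hB.exists_pos
  set K := (M ^ 2 * b / η) ^ 2 / 2 with hKdef
  have hK : 0 < K := by positivity
  have hsqrt : √(2 * K) = M ^ 2 * b / η := by
    rw [hKdef, mul_div_cancel₀ _ two_ne_zero, Real.sqrt_sq (by positivity)]
  refine ⟨K, hK, fun n hn => ?_⟩
  filter_upwards [hSM.bound, hBb.bound, hn, self_mem_nhdsWithin] with ε hSε hBε hnε hε
  replace hε : 0 < ε := hε
  rw [norm_norm, Real.norm_of_nonneg (by positivity)] at hSε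
  rw [Real.norm_of_nonneg (by positivity), Real.norm_of_nonneg (B_nonneg ..)] at hBε
  have htail : ∀ j, coeff φ (S ε - truncation φ (n ε) (S ε)) j ≠ 0 →
      weight κ ε j ≤ (√(2 * K))⁻¹ * ε ^ e := fun j hj => by
    rw [coeff_sub_truncation hφ, Ne, ite_eq_left_iff, Classical.not_imp, not_le] at hj
    exact weight_le_rpow hA1 hA2 hε hK (hnε.trans (by exact_mod_cast hj.1.le))
  have hnorm : ‖S ε - truncation φ (n ε) (S ε)‖ ≤ M * ε ^ q :=
    (norm_sub_fourierSum_le hφ _ _).trans hSε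
  calc B φ κ ε (S ε - truncation φ (n ε) (S ε))
      ≤ (√(2 * K))⁻¹ * ε ^ e * (M * ε ^ q / ε) ^ 2 :=
        (B_le_mul_norm_sq hφ hA1 hε (by positivity) htail).trans (by gcongr)
    _ = η * (b⁻¹ * (ε ^ e * (ε ^ q / ε) ^ 2)) := by rw [hsqrt]; field_simp
    _ ≤ η * B φ κ ε (S ε) := by
        rw [rpow_mul_div_sq hε, inv_mul_eq_div]
        gcongr
        rwa [div_le_iff₀' hb]

theorem isBigO_norm_of_B_sub_le (hφ : Orthonormal ℝ φ) (hA1 : CondA1 κ)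
    (hw : (fun ε => weight κ ε 1) =O[𝓝[>] (0 : ℝ)] fun ε => ε ^ e)
    (hB : (fun ε => ε ^ (e + 2 * q - 2)) =O[𝓝[>] 0] fun ε => B φ κ ε (S ε))
    (hadd : ∀ᶠ ε in 𝓝[>] (0 : ℝ),
      B φ κ ε (S₁ ε) + B φ κ ε (S ε - S₁ ε) = B φ κ ε (S ε)) {η : ℝ} (hη : η < 1)
    (hsub : ∀ᶠ ε in 𝓝[>] (0 : ℝ), B φ κ ε (S ε - S₁ ε) ≤ η * B φ κ ε (S ε)) :
    (fun ε => ε ^ q) =O[𝓝[>] 0] fun ε => ‖S₁ ε‖ := by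
  have hBB₁ : (fun ε => B φ κ ε (S ε)) =O[𝓝[>] 0] fun ε => B φ κ ε (S₁ ε) := by
    refine IsBigO.of_bound (1 - η)⁻¹ ?_
    filter_upwards [hadd, hsub] with ε hadd hsub
    rw [Real.norm_of_nonneg (B_nonneg ..), Real.norm_of_nonneg (B_nonneg ..),
      le_inv_mul_iff₀ (sub_pos.2 hη)]
    linarith
  have hB₁ : (fun ε => B φ κ ε (S₁ ε)) =O[𝓝[>] 0]
      fun ε => weight κ ε 1 * (‖S₁ ε‖ / ε) ^ 2 := by
    refine IsBigO.of_bound' ?_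
    filter_upwards [self_mem_nhdsWithin] with ε hε
    rw [Real.norm_of_nonneg (B_nonneg ..)]
    exact (B_le_mul_norm_sq hφ hA1 hε (weight_nonneg ..)
      fun j _ => weight_le_weight_one hA1 hε j).trans (le_abs_self _)
  have hchain := (((hB.trans hBB₁).trans hB₁).trans (hw.mul (isBigO_refl _ _))).mul
    (isBigO_refl (fun ε : ℝ => ε ^ (2 - e)) (𝓝[>] 0))
  refine IsBigO.of_pow two_ne_zero (hchain.congr' ?_ ?_) <;>
    filter_upwards [self_mem_nhdsWithin] with ε hε <;> replace hε : 0 < ε := hε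
  · rw [Pi.pow_apply, ← Real.rpow_add hε, ← Real.rpow_mul_natCast hε.le, Nat.cast_ofNat]
    congr 1
    ring
  · rw [Pi.pow_apply, mul_right_comm, ← Real.rpow_add hε, add_sub_cancel, Real.rpow_two, div_pow,
      mul_div_cancel₀ _ (by positivity)]

theorem eventually_B_truncation_add_B_sub_truncation (hφ : Orthonormal ℝ φ) (hA1 : CondA1 κ)
    (n : ℝ → ℕ) (S : ℝ → L2) : ∀ᶠ ε in 𝓝[>] (0 : ℝ),
      B φ κ ε (truncation φ (n ε) (S ε)) + B φ κ ε (S ε - truncation φ (n ε) (S ε)) =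
        B φ κ ε (S ε) :=
  eventually_nhdsWithin_of_forall fun _ hε =>
    B_truncation_add_B_sub_truncation hφ hA1 hε _ _

theorem isTheta_norm_truncation (hφ : Orthonormal ℝ φ) (hA1 : CondA1 κ)
    (hw : (fun ε => weight κ ε 1) =O[𝓝[>] (0 : ℝ)] fun ε => ε ^ e)
    (hS : (fun ε => ‖S ε‖) =O[𝓝[>] 0] fun ε => ε ^ q)
    (hB : (fun ε => ε ^ (e + 2 * q - 2)) =O[𝓝[>] 0] fun ε => B φ κ ε (S ε)) {n : ℝ → ℕ} {η : ℝ}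
    (hη : η < 1) (hsub : ∀ᶠ ε in 𝓝[>] (0 : ℝ),
      B φ κ ε (S ε - truncation φ (n ε) (S ε)) ≤ η * B φ κ ε (S ε)) :
    (fun ε => ‖truncation φ (n ε) (S ε)‖) =Θ[𝓝[>] 0] fun ε => ε ^ q :=
  ⟨(IsBigO.of_norm_le fun _ => (norm_norm _).trans_le (norm_fourierSum_le hφ _ _)).trans hS,
    isBigO_norm_of_B_sub_le hφ hA1 hw hB
      (eventually_B_truncation_add_B_sub_truncation hφ hA1 n S) hη hsub⟩

theorem exists_truncation_mem_besovBall {r : ℝ} (hφ : Orthonormal ℝ φ) (hA1 : CondA1 κ)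
    (hA2 : CondA2 κ) (hr : 0 < r) (he : 0 < e)
    (hS : (fun ε => ‖S ε‖) =O[𝓝[>] 0] fun ε => ε ^ (2 * r))
    (hB : (fun ε => ε ^ (e + 2 * (2 * r) - 2)) =O[𝓝[>] 0] fun ε => B φ κ ε (S ε)) {η : ℝ}
    (hη : 0 < η) :
    ∃ n : ℝ → ℕ, (∃ P > 0, ∀ ε > 0, truncation φ (n ε) (S ε) ∈ besovBall φ (r / e) P) ∧
      ∀ᶠ ε in 𝓝[>] (0 : ℝ),
        B φ κ ε (S ε - truncation φ (n ε) (S ε)) ≤ η * B φ κ ε (S ε) := by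
  obtain ⟨K, hK, hsub⟩ := exists_level_B_sub_truncation_le hφ hA1 hA2 hS hB hη
  have hexp : 2 * r = e * (2 * (r / e)) := by rw [mul_left_comm, mul_div_cancel₀ _ he.ne']
  obtain ⟨n, hn, P, hP, hnP⟩ := exists_level_rpow_mul_sq_le he.le (by positivity) hK.le (hexp ▸ hS)
  exact ⟨n, ⟨P, hP, fun ε hε => truncation_mem_besovBall hφ _ _ (by positivity) (hnP ε hε)⟩,
    hsub n hn⟩

end TruncationLevel

end QuadTest

end

open QuadTest in
theorem mainTheorem7_general
    (φ : ℕ+ → L2) (hφ : Orthonormal ℝ φ) (κ : ℝ → ℕ → ℝ) (hκ : WeightsSummable κ)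
    (hA1 : CondA1 κ) (hA2 : CondA2 κ)
    (hκ₁ : (fun ε => κ ε 1 ^ 2) =O[𝓝[>] (0 : ℝ)] fun ε => kappaSq κ ε)
    (r ω : ℝ) (hr₀ : 0 < r) (hω₀ : 0 < ω) (hω : 2 * ω < 1 - 2 * r)
    (hk : (fun ε => (kEff κ ε : ℝ)) =Θ[𝓝[>] (0 : ℝ)] fun ε => ε ^ (-4 + 8 * r + 4 * ω))
    (δ : ℝ) (hδ : 0 < δ) (c : ℝ) (hc : 0 < c) (S : ℝ → L2)
    (hS : (fun ε => ‖S ε‖) =O[𝓝[>] (0 : ℝ)] fun ε => ε ^ (2 * r))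
    (hcons : IsLDConsistent φ κ (fun ε => ε ^ (-2 * ω)) S) :
    ∃ P₀ : ℝ, 0 < P₀ ∧ ∃ S₁ : ℝ → L2,
      (∀ ε : ℝ, 0 < ε → S₁ ε ∈ besovBall φ (r / (2 - 4 * r - 2 * ω)) P₀) ∧
      ((fun ε => ‖S₁ ε‖) =Θ[𝓝[>] (0 : ℝ)] fun ε => ε ^ (2 * r)) ∧
      (∀ ε : ℝ, 0 < ε → inner ℝ (S₁ ε) (S ε - S₁ ε) = 0) ∧
      ∀ x : ℝ → ℝ, AdmissibleTests φ κ c S x →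
        ∃ ε₀ : ℝ, 0 < ε₀ ∧ ∀ ε : ℝ, 0 < ε → ε < ε₀ →
          IsTypeIIApprox φ κ δ ε (x ε) (S ε) (S₁ ε) := by
  set e := 2 - 4 * r - 2 * ω with he
  have he₀ : 0 < e := by linarith
  rw [show -4 + 8 * r + 4 * ω = -2 * e by ring] at hk
  have hw := isBigO_weight_one hA1 hA2 hκ₁ hk.2
  have hB := hcons.isBigO_B hφ hκ hA1 hA2 (tendsto_rpow_neg_nhdsGT_zero (by linarith))
    (tendsto_weight_one_mul_zero hw (isLittleO_rpow_rpow_nhdsGT_zero (by linarith)))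
  rw [show -2 * ω = e + 2 * (2 * r) - 2 by ring] at hB
  obtain ⟨τ, hτ, hτ₁⟩ := exists_between (show 0 < min (1 / 4) (δ / 6) by positivity)
  rw [lt_min_iff, lt_div_iff₀' (by norm_num : (0 : ℝ) < 6)] at hτ₁
  obtain ⟨n, ⟨P, hP, hmem⟩, hsub⟩ := exists_truncation_mem_besovBall hφ hA1 hA2 hr₀ he₀ hS hB
    (show 0 < min (τ * c) (1 / 2) by positivity)
  refine ⟨P, hP, fun ε => QuadTest.truncation φ (n ε) (S ε), hmem,
    isTheta_norm_truncation hφ hA1 hw hS hB (min_lt_of_right_lt one_half_lt_one) hsub,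
    fun ε _ => inner_fourierSum_sub_fourierSum hφ _ _, fun x hx => ?_⟩
  have hwB := tendsto_weight_one_mul_zero hw (hx.isLittleO_B hA2 hk.1)
  have hτc : ∀ᶠ ε in 𝓝[>] (0 : ℝ),
      B φ κ ε (S ε - QuadTest.truncation φ (n ε) (S ε)) ≤ τ * c * B φ κ ε (S ε) :=
    hsub.mono fun ε h => h.trans (mul_le_mul_of_nonneg_right (min_le_left _ _) (B_nonneg ..))
  obtain ⟨ε₀, hε₀, happrox⟩ := mem_nhdsGT_iff_exists_Ioo_subset.1
    (hx.eventually_isTypeIIApprox hφ hκ hA1 hA2 hc hwB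
      (eventually_B_truncation_add_B_sub_truncation hφ hA1 n S) hτc hτ hτ₁.1.le hτ₁.2.le)
  exact ⟨ε₀, hε₀, fun ε hε hεε₀ => happrox ⟨hε, hεε₀⟩⟩

theorem mainTheorem7
    (φ : ℕ+ → QuadTest.L2) (hφ : Orthonormal ℝ φ)
    (κ : ℝ → ℕ → ℝ) (hκ : QuadTest.WeightsSummable κ)
    (hA1 : QuadTest.CondA1 κ) (hA2 : QuadTest.CondA2 κ)
    (hA3 : QuadTest.CondA3 κ) (hA4 : QuadTest.CondA4 κ)
    (r ω : ℝ) (hr₀ : 0 < r) (hr : r < 1 / 2) (hω₀ : 0 < ω) (hω : 2 * ω < 1 - 2 * r)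
    (hk : (fun ε => (QuadTest.kEff κ ε : ℝ)) =Θ[𝓝[>] (0 : ℝ)]
      fun ε => ε ^ (-4 + 8 * r + 4 * ω))
    (δ : ℝ) (hδ : 0 < δ) (c : ℝ) (hc : 0 < c)
    (S : ℝ → QuadTest.L2)
    (hS : (fun ε => ‖S ε‖) =Θ[𝓝[>] (0 : ℝ)] fun ε => ε ^ (2 * r))
    (hcons : QuadTest.IsLDConsistent φ κ (fun ε => ε ^ (-2 * ω)) S) :
    ∃ P₀ : ℝ, 0 < P₀ ∧ ∃ S₁ : ℝ → QuadTest.L2,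
      (∀ ε : ℝ, 0 < ε →
        S₁ ε ∈ QuadTest.besovBall φ (r / (2 - 4 * r - 2 * ω)) P₀) ∧
      ((fun ε => ‖S₁ ε‖) =Θ[𝓝[>] (0 : ℝ)] fun ε => ε ^ (2 * r)) ∧
      (∀ ε : ℝ, 0 < ε → inner ℝ (S₁ ε) (S ε - S₁ ε) = 0) ∧
      ∀ x : ℝ → ℝ, QuadTest.AdmissibleTests φ κ c S x →
        ∃ ε₀ : ℝ, 0 < ε₀ ∧ ∀ ε : ℝ, 0 < ε → ε < ε₀ →
          (ENNReal.log (QuadTest.typeII φ κ ε (x ε) (S ε)) -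
              ENNReal.log (QuadTest.typeII φ κ ε (x ε) (S₁ ε))).abs ≤
            ENNReal.ofReal δ * QuadTest.absLog (QuadTest.typeII φ κ ε (x ε) (S ε)) ∧
          QuadTest.absLog (QuadTest.typeII φ κ ε (x ε) (S ε - S₁ ε)) ≤
            ENNReal.ofReal δ * QuadTest.absLog (QuadTest.typeII φ κ ε (x ε) (S ε)) :=
  mainTheorem7_general φ hφ κ hκ hA1 hA2 hA4.1.1 r ω hr₀ hω₀ hω hk δ hδ c hc S hS.1 hcons
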